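/- Let $N\ge 4$, let $\Sigma$ be a smooth manifold of dimension $N-1$ (Hausdorff, second countable), and let $\mathcal V_\Sigma\to\Sigma$ be a smooth vector bundle of rank $N$ with a smooth fibre metric $\eta$ of Lorentzian signature $(-,+,\dots,+)$. Put $\Omega_\partial^{i,j}=\Omega^i(\Sigma,\bigwedge^j\mathcal V_\Sigma)$ (smooth forms); products are wedge products in both the form and the internal indices, with signs given by the total degree $i+j$. Let $e\in\Omega_\partial^{1,1}$ be a boundary coframe, i.e. a smooth fibrewise injective bundle map $e:T\Sigma\to\mathcal V_\Sigma$, such that the induced metric $g^\partial=e^*\eta$ is degenerate at every point of $\Sigma$, and let $e_n\in\Omega_\partial^{0,1}$ be a section of $\mathcal V_\Sigma$ with $e_n(x)\notin e(T_x\Sigma)$ for all $x\in\Sigma$. Fix a smooth $\eta$-compatible reference connection $\omega_0$ on $\mathcal V_\Sigma$, and identify $\omega\in\Omega_\partial^{1,2}$ with the connection $\omega_0+\omega$ through $\bigwedge^2\mathcal V_\Sigma\cong\mathfrak{so}(\mathcal V_\Sigma,\eta)$; $d_\omega$ is the exterior covariant derivative of this connection, so that $d_\omega e\in\Omega_\partial^{2,1}$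 is $d_\omega e(X,Y)=\nabla^\omega_X(eY)-\nabla^\omega_Y(eX)-e[X,Y]$. Let $W_k^{\partial,(i,j)}:\Omega_\partial^{i,j}\to\Omega_\partial^{i+k,j+k}$, $X\mapsto X\wedge e^k$, and let $\varrho:\Omega_\partial^{1,2}\to\Omega_\partial^{2,1}$, $\varrho(X)=[X,e]$, that is, $[X,e]_{\mu\nu}^a=X_\mu^{ab}\eta_{bc}e_\nu^c-X_\nu^{ab}\eta_{bc}e_\mu^c$. Let $J$ be a linear complement of $\varrho(\operatorname{Ker}W_{N-3}^{\partial,(1,2)})$ in $\Omega_\partial^{2,1}$ and put $$\mathcal T=\operatorname{Ker}W_{N-3}^{\partial,(2,1)}\cap J,\qquad \mathcal K=\operatorname{Ker}W_{N-3}^{\partial,(1,2)}\cap\operatorname{Ker}\varrho .$$ Let $p_{\mathcal K}:\Omega_\partial^{1,2}\to\mathcal K$ be a linear projection onto $\mathcal K$. Let $h$ be a Riemannian metric on $\Sigma$, extended to a positive definite fibre metric on $\mathcal V_\Sigma$ for which $e$ is isometric and $e_n$ is orthogonal to $e(T\Sigma)$, and let $p_{\mathcal T}:\Omega_\partial^{2,1}\to\mathcal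 T$ be the orthogonal projection onto $\mathcal T$ for the induced pointwise inner product on $\bigwedge^2T^*\Sigma\otimes\mathcal V_\Sigma$ (assumed to exist, as it does e.g. when $J$ is the pointwise orthogonal complement). Then every $\widetilde\omega\in\Omega_\partial^{1,2}$ can be written in a unique way as $\widetilde\omega=\omega+v$ with $\omega,v\in\Omega_\partial^{1,2}$ satisfying $$e^{N-3}v=0,\qquad e_ne^{N-4}d_\omega e-e_ne^{N-4}p_{\mathcal T}(d_\omega e)\in\operatorname{Im}W_{N-3}^{\partial,(1,1)},\qquad p_{\mathcal K}v=0 .$$ -/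

import Mathlib

open Bundle Module
open scoped Manifold ContDiff

noncomputable section

namespace PalatiniCartan

/-! Throughout, `S` is the boundary manifold (modelled on `E`, so that `dim S = dim E`) and `V` is a
vector bundle over `S` with model fibre `F`, playing the role of the restricted bundle `𝒱_Σ`. -/

section Basic

variable (E : Type*) [NormedAddCommGroup E] [NormedSpace ℝ E]
  {S : Type*} [TopologicalSpace S] [ChartedSpace E S]
  (V : S → Type*) [∀ x, AddCommGroup (V x)] [∀ x, Module ℝ (V x)]

/-- The algebra `Λ(T_x^*S ⊕ V_x) = ⨁_{i,j} Λ^i T_x^*S ⊗ Λ^j V_x`. Its product is the wedge product on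
both the form indices and the internal indices, and bihomogeneous elements satisfy
`α β = (-1)^((i+j)(k+l)) β α`, the sign rule of the total degree. -/
abbrev FormFibre (x : S) : Type _ :=
  ExteriorAlgebra ℝ (Dual ℝ (TangentSpace 𝓘(ℝ, E) x) × V x)

/-- Not necessarily smooth fields of forms with values in `ΛV`; multiplication is the pointwise
wedge product. -/
abbrev FormField : Type _ := (x : S) → FormFibre E V x

/-- A covector as an element of bidegree `(1, 0)`. -/
def covec (x : S) : Dual ℝ (TangentSpace 𝓘(ℝ, E) x) →ₗ[ℝ] FormFibre E V x :=
  ExteriorAlgebra.ι ℝ ∘ₗ LinearMap.inl ℝ _ _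

/-- A vector of `V_x` as an element of bidegree `(0, 1)`. -/
def vec (x : S) : V x →ₗ[ℝ] FormFibre E V x :=
  ExteriorAlgebra.ι ℝ ∘ₗ LinearMap.inr ℝ _ _

/-- The component in `V_x` (bidegree `(0, 1)`) of an element. -/
def vecPart (x : S) : FormFibre E V x →ₗ[ℝ] V x :=
  LinearMap.snd ℝ _ _ ∘ₗ ExteriorAlgebra.ιInv

/-- `Λ^i T_x^*S ⊗ Λ^j V_x`, spanned by the products of `i` covectors and `j` vectors. -/
def bidegree (i j : ℕ) (x : S) : Submodule ℝ (FormFibre E V x) :=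
  LinearMap.range (covec E V x) ^ i * LinearMap.range (vec E V x) ^ j

variable {E V}

/-- Interior product `ι_u` with a tangent vector (it removes the first form index). -/
def insertVec {x : S} (u : TangentSpace 𝓘(ℝ, E) x) : FormFibre E V x →ₗ[ℝ] FormFibre E V x :=
  CliffordAlgebra.contractLeft (Dual.eval ℝ _ u ∘ₗ LinearMap.fst ℝ _ _)

/-- Contraction of the last internal index with an element of the dual of `V_x`. -/
def contractInternal {x : S} (d : Dual ℝ (V x)) : FormFibre E V x →ₗ[ℝ] FormFibre E V x :=
  CliffordAlgebra.contractRight.flip (d ∘ₗ LinearMap.snd ℝ _ _)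

/-- The value `α(u, w) ∈ V_x` of `α ∈ Λ²T_x^*S ⊗ V_x`. -/
def eval21 {x : S} (α : FormFibre E V x) (u w : TangentSpace 𝓘(ℝ, E) x) : V x :=
  vecPart E V x (insertVec w (insertVec u α))

end Basic

section Bundle

variable (E : Type*) [NormedAddCommGroup E] [NormedSpace ℝ E]
  {S : Type*} [TopologicalSpace S] [ChartedSpace E S] [IsManifold 𝓘(ℝ, E) ∞ S]
  (F : Type*) [NormedAddCommGroup F] [NormedSpace ℝ F]
  (V : S → Type*) [TopologicalSpace (TotalSpace F V)]
  [∀ x, AddCommGroup (V x)] [∀ x, Module ℝ (V x)] [∀ x, TopologicalSpace (V x)]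
  [∀ x, IsTopologicalAddGroup (V x)] [∀ x, ContinuousSMul ℝ (V x)]
  [FiberBundle F V] [VectorBundle ℝ F V]

/-- The identification of `T_x^*S ⊕ V_x`, for `x` near `x₀`, with `E^* ⊕ F` given by the preferred
trivializations of `TS` and `V` at `x₀`. -/
def coordMap (x₀ x : S) :
    (Dual ℝ (TangentSpace 𝓘(ℝ, E) x) × V x) →ₗ[ℝ] (Dual ℝ E × F) :=
  LinearMap.prodMap
    (((trivializationAt E (TangentSpace 𝓘(ℝ, E) : S → Type _) x₀).symmₗ ℝ x).dualMap)
    ((trivializationAt F V x₀).linearMapAt ℝ x)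

/-- Smoothness: near every point all components in local trivializations are smooth functions. -/
def IsSmoothField (α : FormField E V) : Prop :=
  ∀ (x₀ : S) (l : Dual ℝ (ExteriorAlgebra ℝ (Dual ℝ E × F))),
    ContMDiffAt 𝓘(ℝ, E) 𝓘(ℝ, ℝ) ∞
      (fun x ↦ l (ExteriorAlgebra.map (coordMap E F V x₀ x) (α x))) x₀

/-- `Ω_∂^{i,j} = Ω^i(S, Λ^j V)`: the smooth `i`-forms on `S` with values in `Λ^j V`. -/
def Omega (i j : ℕ) : Submodule ℝ (FormField E V) where
  carrier := {α | (∀ x, α x ∈ bidegree E V i j x) ∧ IsSmoothField E F V α}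
  add_mem' := by
    rintro α β ⟨ha, hsa⟩ ⟨hb, hsb⟩
    refine ⟨fun x ↦ Submodule.add_mem _ (ha x) (hb x), fun x₀ l ↦ ?_⟩
    simp only [Pi.add_apply, map_add]
    exact (hsa x₀ l).add (hsb x₀ l)
  zero_mem' := by
    refine ⟨fun x ↦ Submodule.zero_mem _, fun x₀ l ↦ ?_⟩
    simpa using contMDiffAt_const
  smul_mem' := by
    rintro c α ⟨ha, hsa⟩
    refine ⟨fun x ↦ Submodule.smul_mem _ c (ha x), fun x₀ l ↦ ?_⟩
    simp only [Pi.smul_apply, map_smul]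
    have hc : ContMDiffAt 𝓘(ℝ, E) 𝓘(ℝ, ℝ) ∞ (fun _ : S ↦ c) x₀ := contMDiffAt_const
    exact hc.smul (hsa x₀ l)

/-- A smooth fibre metric on `V` of Lorentzian signature `(-, +, …, +)`. -/
structure LorentzMetric where
  inner (x : S) : V x →L[ℝ] V x →L[ℝ] ℝ
  symm (x : S) (s t : V x) : inner x s t = inner x t s
  lorentzian (x : S) : ∃ t : V x, inner x t t < 0 ∧
    ∀ s : V x, inner x t s = 0 → s ≠ 0 → 0 < inner x s s
  contMDiff : ContMDiff 𝓘(ℝ, E) (𝓘(ℝ, E).prod 𝓘(ℝ, F →L[ℝ] F →L[ℝ] ℝ)) ∞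
    (fun x ↦ TotalSpace.mk' (F →L[ℝ] F →L[ℝ] ℝ) (E := fun x ↦ V x →L[ℝ] V x →L[ℝ] ℝ) x (inner x))

/-- A boundary coframe: a smooth, fibrewise injective bundle map `e : TS → V`. -/
structure BoundaryCoframe where
  toFun (x : S) : TangentSpace 𝓘(ℝ, E) x →L[ℝ] V x
  injective (x : S) : Function.Injective (toFun x)
  contMDiff : ContMDiff 𝓘(ℝ, E) (𝓘(ℝ, E).prod 𝓘(ℝ, E →L[ℝ] F)) ∞
    (fun x ↦ TotalSpace.mk' (E →L[ℝ] F)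
      (E := fun x ↦ TangentSpace 𝓘(ℝ, E) x →L[ℝ] V x) x (toFun x))

/-- A smooth section of `V` which is transversal to `e(TS)` at every point. -/
structure TransversalSection (e : BoundaryCoframe E F V) where
  toFun (x : S) : V x
  transversal (x : S) : toFun x ∉ Set.range (e.toFun x)
  contMDiff : ContMDiff 𝓘(ℝ, E) (𝓘(ℝ, E).prod 𝓘(ℝ, F)) ∞ (fun x ↦ TotalSpace.mk' F x (toFun x))

variable {E F V}

/-- The induced boundary metric `g^∂ = e^*η`. -/
def boundaryMetric (η : LorentzMetric E F V) (e : BoundaryCoframe E F V) (x : S)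
    (u w : TangentSpace 𝓘(ℝ, E) x) : ℝ :=
  η.inner x (e.toFun x u) (e.toFun x w)

/-- The boundary metric is degenerate (light-like) at every point. -/
def IsDegenerate (η : LorentzMetric E F V) (e : BoundaryCoframe E F V) : Prop :=
  ∀ x : S, ∃ u : TangentSpace 𝓘(ℝ, E) x, u ≠ 0 ∧ ∀ w, boundaryMetric η e x u w = 0

/-- The functional `η(s, ·)` on `V_x`. -/
def flat (η : LorentzMetric E F V) {x : S} (s : V x) : Dual ℝ (V x) :=
  (η.inner x s : V x →ₗ[ℝ] ℝ)

/-- The value at `s ∈ V_x` of the endomorphism `A(u) ∈ Λ²V_x ≅ 𝔰𝔬(V_x, η)`, where `A` has bidegree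
`(1, 2)`; here `a ∧ b` acts by `s ↦ a η(b, s) - b η(a, s)`. -/
def act (η : LorentzMetric E F V) {x : S} (A : FormFibre E V x)
    (u : TangentSpace 𝓘(ℝ, E) x) (s : V x) : V x :=
  vecPart E V x (contractInternal (flat η s) (insertVec u A))

section FiniteDim

variable [FiniteDimensional ℝ E]

/-- A basis of the tangent space; the definitions below do not depend on it. -/
def tangentBasis (x : S) : Basis (Fin (finrank ℝ E)) ℝ (TangentSpace 𝓘(ℝ, E) x) :=
  finBasis ℝ E

/-- The coframe as a field of bidegree `(1, 1)`: `e = ∑_μ dx^μ e_μ`. -/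
def coframeForm (e : BoundaryCoframe E F V) : FormField E V := fun x ↦
  ∑ μ, covec E V x ((tangentBasis x).coord μ) * vec E V x (e.toFun x (tangentBasis x μ))

/-- The map `X ↦ X ∧ e ∧ ⋯ ∧ e` (`k` factors `e`). -/
def wedgePow (e : BoundaryCoframe E F V) (k : ℕ) : FormField E V →ₗ[ℝ] FormField E V :=
  LinearMap.mulRight ℝ (coframeForm e ^ k)

/-- `Ker W_k^{∂,(i,j)}`. -/
def kerW (e : BoundaryCoframe E F V) (k i j : ℕ) : Submodule ℝ (FormField E V) :=
  Omega E F V i j ⊓ LinearMap.ker (wedgePow e k)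

/-- `Im W_k^{∂,(i,j)}`. -/
def imW (e : BoundaryCoframe E F V) (k i j : ℕ) : Submodule ℝ (FormField E V) :=
  (Omega E F V i j).map (wedgePow e k)

/-- `ϱ^{(1,2)} : X ↦ [X, e]`, in components
`[X, e]_{μν}^a = X_μ^{ab} η_{bc} e_ν^c - X_ν^{ab} η_{bc} e_μ^c`. -/
def rho (η : LorentzMetric E F V) (e : BoundaryCoframe E F V) :
    FormField E V →ₗ[ℝ] FormField E V where
  toFun X := fun x ↦ -∑ ν, covec E V x ((tangentBasis x).coord ν) *
    contractInternal (flat η (e.toFun x (tangentBasis x ν))) (X x)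
  map_add' X Y := by
    funext x
    simp only [Pi.add_apply, map_add, mul_add, Finset.sum_add_distrib, neg_add]
  map_smul' c X := by
    funext x
    simp only [Pi.smul_apply, map_smul, mul_smul_comm, ← Finset.smul_sum, smul_neg,
      RingHom.id_apply]

/-- `Im ϱ^{(1,2)}|_{Ker W_{N-3}^{∂,(1,2)}}`. -/
def imRho (η : LorentzMetric E F V) (e : BoundaryCoframe E F V) (N : ℕ) :
    Submodule ℝ (FormField E V) :=
  (kerW e (N - 3) 1 2).map (rho η e)

/-- `J` is a complement of `Im ϱ^{(1,2)}|_{Ker W_{N-3}^{∂,(1,2)}}` in `Ω_∂^{2,1}`. -/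
def IsComplement (η : LorentzMetric E F V) (e : BoundaryCoframe E F V) (N : ℕ)
    (J : Submodule ℝ (FormField E V)) : Prop :=
  imRho η e N ⊓ J = ⊥ ∧ imRho η e N ⊔ J = Omega E F V 2 1

/-- `𝒯 = Ker W_{N-3}^{∂,(2,1)} ∩ J`. -/
def spaceT (e : BoundaryCoframe E F V) (N : ℕ) (J : Submodule ℝ (FormField E V)) :
    Submodule ℝ (FormField E V) :=
  kerW e (N - 3) 2 1 ⊓ J

/-- `𝒦 = Ker W_{N-3}^{∂,(1,2)} ∩ Ker ϱ^{(1,2)}`. -/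
def spaceK (η : LorentzMetric E F V) (e : BoundaryCoframe E F V) (N : ℕ) :
    Submodule ℝ (FormField E V) :=
  kerW e (N - 3) 1 2 ⊓ LinearMap.ker (rho η e)

/-- The restriction of the linear map `p` to `D` is a projection of `D` onto `T`. -/
def IsProjection (D T : Submodule ℝ (FormField E V)) (p : FormField E V →ₗ[ℝ] FormField E V) :
    Prop :=
  T ≤ D ∧ (∀ α ∈ D, p α ∈ T) ∧ ∀ α ∈ T, p α = α

end FiniteDim

section Riemannian

/-- The fibre metric `G` on `V` extends the Riemannian metric `h` on `S` along the decomposition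
`V = e(TS) ⊕ ℝ e_n`: the map `e` is isometric and `e_n` is orthogonal to `e(TS)`. -/
def ExtendsMetric (e : BoundaryCoframe E F V) (en : TransversalSection E F V e)
    (h : ContMDiffRiemannianMetric 𝓘(ℝ, E) ∞ E (TangentSpace 𝓘(ℝ, E) : S → Type _))
    (G : ContMDiffRiemannianMetric 𝓘(ℝ, E) ∞ F V) : Prop :=
  ∀ (x : S) (u : TangentSpace 𝓘(ℝ, E) x),
    G.inner x (en.toFun x) (e.toFun x u) = 0 ∧
      ∀ w, G.inner x (e.toFun x u) (e.toFun x w) = h.inner x u w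

/-- Pointwise orthogonality in `Λ²T^*S ⊗ V` with respect to the metric induced by `h` and `G`. -/
def Orthogonal21
    (h : ContMDiffRiemannianMetric 𝓘(ℝ, E) ∞ E (TangentSpace 𝓘(ℝ, E) : S → Type _))
    (G : ContMDiffRiemannianMetric 𝓘(ℝ, E) ∞ F V) (α β : FormField E V) : Prop :=
  ∀ (x : S) (b : Basis (Fin (finrank ℝ E)) ℝ (TangentSpace 𝓘(ℝ, E) x)),
    (∀ i j, h.inner x (b i) (b j) = if i = j then 1 else 0) →
      ∑ i, ∑ j, G.inner x (eval21 (α x) (b i) (b j)) (eval21 (β x) (b i) (b j)) = 0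

/-- `p` restricts to the orthogonal projection of `Ω_∂^{2,1}` onto `T`. -/
def IsOrthogonalProjection21
    (h : ContMDiffRiemannianMetric 𝓘(ℝ, E) ∞ E (TangentSpace 𝓘(ℝ, E) : S → Type _))
    (G : ContMDiffRiemannianMetric 𝓘(ℝ, E) ∞ F V) (T : Submodule ℝ (FormField E V))
    (p : FormField E V →ₗ[ℝ] FormField E V) : Prop :=
  IsProjection (Omega E F V 2 1) T p ∧
    ∀ α ∈ Omega E F V 2 1, ∀ θ ∈ T, Orthogonal21 h G (α - p α) θ

end Riemannian

section Connection

/-- The connection is compatible with `η`: `d(η(σ, τ)) = η(∇σ, τ) + η(σ, ∇τ)`. -/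
def IsMetricConnection (η : LorentzMetric E F V)
    (ω₀ : CovariantDerivative 𝓘(ℝ, E) F V) : Prop :=
  ∀ (x : S) (u : TangentSpace 𝓘(ℝ, E) x) (σ τ : (y : S) → V y),
    MDifferentiableAt 𝓘(ℝ, E) (𝓘(ℝ, E).prod 𝓘(ℝ, F)) (fun y ↦ TotalSpace.mk' F y (σ y)) x →
    MDifferentiableAt 𝓘(ℝ, E) (𝓘(ℝ, E).prod 𝓘(ℝ, F)) (fun y ↦ TotalSpace.mk' F y (τ y)) x →
      mvfderiv 𝓘(ℝ, E) (fun y ↦ η.inner y (σ y) (τ y)) x u =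
        η.inner x (ω₀ σ x u) (τ x) + η.inner x (σ x) (ω₀ τ x u)

/-- The covariant derivative `(∇^ω_u σ)(x)` of the connection `ω = ω₀ + A`, for `A` of bidegree
`(1, 2)`. -/
def covDeriv (η : LorentzMetric E F V) (ω₀ : CovariantDerivative 𝓘(ℝ, E) F V)
    (A : FormField E V) (σ : (y : S) → V y) (x : S) (u : TangentSpace 𝓘(ℝ, E) x) : V x :=
  ω₀ σ x u + act η (A x) u (σ x)

/-- `(d_ω e)(u, w)` for `ω = ω₀ + A`, computed as `∇^ω_X (e Y) - ∇^ω_Y (e X) - e [X, Y]` at `x`, for vector fields `X`, `Y` which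
extend `u`, `w`. -/
def torsionValue (η : LorentzMetric E F V) (e : BoundaryCoframe E F V)
    (ω₀ : CovariantDerivative 𝓘(ℝ, E) F V) (A : FormField E V) (x : S)
    (u w : TangentSpace 𝓘(ℝ, E) x) : V x :=
  covDeriv η ω₀ A (fun y ↦ e.toFun y (FiberBundle.extend E w y)) x u
    - covDeriv η ω₀ A (fun y ↦ e.toFun y (FiberBundle.extend E u y)) x w
    - e.toFun x (VectorField.mlieBracket 𝓘(ℝ, E)
        (FiberBundle.extend E u) (FiberBundle.extend E w) x)

/-- `d_ω e`, for the connection `ω = ω₀ + A`, as a field of bidegree `(2, 1)`: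
`d_ω e = (1/2) ∑_{μ,ν} dx^μ dx^ν (d_ω e)(∂_μ, ∂_ν)`. -/
def dCoframe [FiniteDimensional ℝ E] (η : LorentzMetric E F V) (e : BoundaryCoframe E F V)
    (ω₀ : CovariantDerivative 𝓘(ℝ, E) F V) (A : FormField E V) : FormField E V := fun x ↦
  (1 / 2 : ℝ) • ∑ μ, ∑ ν, covec E V x ((tangentBasis x).coord μ) *
    covec E V x ((tangentBasis x).coord ν) *
      vec E V x (torsionValue η e ω₀ A x (tangentBasis x μ) (tangentBasis x ν))

end Connection

/-- The section `e_n` as a field of bidegree `(0, 1)`. -/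
def transversalForm {e : BoundaryCoframe E F V} (en : TransversalSection E F V e) :
    FormField E V := fun x ↦ vec E V x (en.toFun x)

end Bundle

end PalatiniCartan

end

/-!
The wedge powers of the coframe obey a Lefschetz theory: contracting the form index against the
inverse of `e` on a complement of `e_n` gives an operator `Λ` with `[Λ, e] = m - degree`,
`m = N - 1`, on the forms without `e_n` component. It follows that `Ω^{2,1}` is the direct sum of
`Ker W_{N-3}` and `C = e Ω^{1,0} + Ω^{2,0} e_n`. For `X ∈ Ω^{2,1}` one has
`e_n e^{N-4} X ∈ Im W_{N-3}` exactly when `X ∈ C`, and `p_𝒯` vanishes on `C`, because `C` is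
pointwise orthogonal to `Ker W_{N-3}`. So the constraint on `D = d_ω e` says that `D - p_𝒯 D ∈ C`,
that is, `D ∈ 𝒯 ⊕ C`. Since `ϱ` maps `Ker W_{N-3} ⊆ Ω^{1,2}` into `Ker W_{N-3} ⊆ Ω^{2,1}`, the
modular law splits the latter as `ϱ (Ker W_{N-3}) ⊕ 𝒯`, hence
`Ω^{2,1} = ϱ (Ker W_{N-3}) ⊕ (𝒯 ⊕ C)`. Finally `d_{ω' - v} e = d_{ω'} e - ϱ v`, so the constraint
determines `ϱ v`, which makes `v` unique modulo `𝒦`, and `p_𝒦 v = 0` fixes it.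
-/

noncomputable section

namespace PalatiniCartan

section ExteriorAlgebra

open ExteriorAlgebra CliffordAlgebra

variable {R M N N' : Type*} [CommRing R] [AddCommGroup M] [Module R M]
  [AddCommGroup N] [Module R N] [AddCommGroup N'] [Module R N']

theorem ι_mul_ι_comm (a b : M) :
    ExteriorAlgebra.ι R a * ExteriorAlgebra.ι R b =
      -(ExteriorAlgebra.ι R b * ExteriorAlgebra.ι R a) :=
  eq_neg_of_add_eq_zero_left (ι_add_mul_swap a b)

theorem commute_ι_mul_ι (a b : M) (X : ExteriorAlgebra R M) :
    Commute (ExteriorAlgebra.ι R a * ExteriorAlgebra.ι R b) X := by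
  induction X using ExteriorAlgebra.induction with
  | algebraMap r => exact (Algebra.commutes r _).symm
  | ι c =>
    rw [commute_iff_eq, mul_assoc, ι_mul_ι_comm b c, mul_neg, ← mul_assoc, ι_mul_ι_comm a c,
      neg_mul, neg_neg, mul_assoc]
  | mul X Y hX hY => exact hX.mul_right hY
  | add X Y hX hY => exact hX.add_right hY

theorem range_ι_comp_mul_le (f : N →ₗ[R] M) (g : N' →ₗ[R] M) :
    LinearMap.range (ExteriorAlgebra.ι R ∘ₗ f) * LinearMap.range (ExteriorAlgebra.ι R ∘ₗ g) ≤
      LinearMap.range (ExteriorAlgebra.ι R ∘ₗ g) * LinearMap.range (ExteriorAlgebra.ι R ∘ₗ f) := by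
  rw [Submodule.mul_le]
  rintro _ ⟨a, rfl⟩ _ ⟨b, rfl⟩
  rw [LinearMap.comp_apply, LinearMap.comp_apply, ι_mul_ι_comm]
  exact Submodule.neg_mem _ (Submodule.mul_mem_mul ⟨b, rfl⟩ ⟨a, rfl⟩)

theorem commute_range_ι_comp (f : N →ₗ[R] M) (g : N' →ₗ[R] M) :
    Commute (LinearMap.range (ExteriorAlgebra.ι R ∘ₗ f))
      (LinearMap.range (ExteriorAlgebra.ι R ∘ₗ g)) :=
  le_antisymm (range_ι_comp_mul_le f g) (range_ι_comp_mul_le g f)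

theorem range_ι_comp_pow_le (f : N →ₗ[R] M) (k : ℕ) :
    LinearMap.range (ExteriorAlgebra.ι R ∘ₗ f) ^ k ≤ ⋀[R]^k M :=
  pow_le_pow_left' (LinearMap.range_comp_le_range _ _) k

theorem contractLeft_mul_of_mem {k : ℕ} {X : ExteriorAlgebra R M} (hX : X ∈ ⋀[R]^k M)
    (d : Dual R M) (Y : ExteriorAlgebra R M) :
    contractLeft d (X * Y) = contractLeft d X * Y + (-1 : R) ^ k • (X * contractLeft d Y) := by
  induction hX using Submodule.pow_induction_on_left' with
  | algebraMap r => simp [← Algebra.smul_def]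
  | add X X' k _ _ hX hX' =>
    rw [add_mul, map_add, hX, hX', map_add, add_mul, add_mul, smul_add]
    abel
  | mem_mul m hm k X _ ih =>
    obtain ⟨m, rfl⟩ := hm
    rw [mul_assoc, contractLeft_ι_mul, ih, contractLeft_ι_mul, pow_succ, sub_mul, mul_add,
      smul_mul_assoc, mul_smul_comm, mul_neg_one, neg_smul, mul_assoc, mul_assoc]
    abel

theorem contractLeft_eq_zero_of_mem_pow {f : N →ₗ[R] M} {d : Dual R M} (h : d ∘ₗ f = 0)
    {k : ℕ} {X : ExteriorAlgebra R M}
    (hX : X ∈ LinearMap.range (ExteriorAlgebra.ι R ∘ₗ f) ^ k) :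
    contractLeft d X = 0 := by
  induction hX using Submodule.pow_induction_on_left' with
  | algebraMap r => exact contractLeft_algebraMap _ d r
  | add X X' _ _ _ hX hX' => rw [map_add, hX, hX', add_zero]
  | mem_mul m hm _ X _ ih =>
    obtain ⟨a, rfl⟩ := hm
    rw [LinearMap.comp_apply, contractLeft_ι_mul, ih, ← LinearMap.comp_apply, h]
    simp

theorem contractLeft_mem_pow (f : N →ₗ[R] M) (d : Dual R M) {k : ℕ} {X : ExteriorAlgebra R M}
    (hX : X ∈ LinearMap.range (ExteriorAlgebra.ι R ∘ₗ f) ^ (k + 1)) :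
    contractLeft d X ∈ LinearMap.range (ExteriorAlgebra.ι R ∘ₗ f) ^ k := by
  induction k generalizing X with
  | zero =>
    rw [zero_add, pow_one] at hX
    obtain ⟨a, rfl⟩ := hX
    rw [LinearMap.comp_apply, contractLeft_ι, pow_zero]
    exact Submodule.algebraMap_mem _
  | succ k ih =>
    rw [pow_succ'] at hX
    induction hX using Submodule.mul_induction_on' with
    | add X _ Y _ hX hY => rw [map_add]; exact Submodule.add_mem _ hX hY
    | mem_mul_mem m hm X hX =>
      obtain ⟨a, rfl⟩ := hm
      rw [LinearMap.comp_apply, contractLeft_ι_mul]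
      refine Submodule.sub_mem _ (Submodule.smul_mem _ _ hX) ?_
      rw [pow_succ']
      exact Submodule.mul_mem_mul ⟨a, rfl⟩ (ih hX)

/-- Euler's identity: both sides are derivations of degree zero in the first factor. -/
theorem sum_ι_mul_contractLeft {κ : Type*} [Fintype κ] {v : κ → M} {d : κ → Dual R M}
    {f : N →ₗ[R] M} (h : ∀ a, ∑ i, d i (f a) • v i = f a) {k : ℕ} {X : ExteriorAlgebra R M}
    (hX : X ∈ LinearMap.range (ExteriorAlgebra.ι R ∘ₗ f) ^ k) {Y : ExteriorAlgebra R M}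
    (hY : ∀ i, contractLeft (d i) Y = 0) :
    ∑ i, ExteriorAlgebra.ι R (v i) * contractLeft (d i) (X * Y) = (k : R) • (X * Y) := by
  induction hX using Submodule.pow_induction_on_left' with
  | algebraMap r => simp [hY, ← Algebra.smul_def]
  | add X X' _ _ _ hX hX' =>
    simp only [add_mul, map_add, mul_add, Finset.sum_add_distrib, hX, hX', smul_add]
  | mem_mul m hm k X _ ih =>
    obtain ⟨a, rfl⟩ := hm
    have anticomm (i : κ) : ExteriorAlgebra.ι R (v i) *
        (ExteriorAlgebra.ι R (f a) * contractLeft (d i) (X * Y)) =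
          -(ExteriorAlgebra.ι R (f a) *
            (ExteriorAlgebra.ι R (v i) * contractLeft (d i) (X * Y))) := by
      rw [← mul_assoc, ι_mul_ι_comm, neg_mul, mul_assoc]
    simp only [LinearMap.comp_apply, mul_assoc, contractLeft_ι_mul, mul_sub, anticomm,
      sub_neg_eq_add, Finset.sum_add_distrib, ← Finset.mul_sum, ih, mul_smul_comm]
    simp_rw [← smul_mul_assoc, ← map_smul, ← Finset.sum_mul, ← map_sum, h]
    simp only [Nat.succ_eq_add_one, Nat.cast_add_one, add_smul, one_smul, map_add, map_smul,
      add_mul, add_comm]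

theorem contractRight_eq_contractLeft {k : ℕ} {X : ExteriorAlgebra R M} (hX : X ∈ ⋀[R]^k M)
    (d : Dual R M) : contractRight X d = (-1 : R) ^ (k + 1) • contractLeft d X := by
  induction hX using Submodule.pow_induction_on_right' with
  | algebraMap r => simp
  | add X X' k _ _ hX hX' => rw [map_add, LinearMap.add_apply, hX, hX', map_add, smul_add]
  | mul_mem k X hX ih m hm =>
    obtain ⟨m, rfl⟩ := hm
    have sign : (-1 : R) ^ (k + 2) * (-1) ^ k = 1 := by
      rw [← pow_add, Even.neg_one_pow ⟨k + 1, by omega⟩]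
    calc contractRight (X * ExteriorAlgebra.ι R m) d
        = d m • X - contractRight X d * ExteriorAlgebra.ι R m := contractRight_mul_ι _ _ _
      _ = d m • X + (-1 : R) ^ (k + 2) • (contractLeft d X * ExteriorAlgebra.ι R m) := by
        rw [ih, pow_succ _ (k + 1), mul_neg_one, neg_smul, smul_mul_assoc, sub_eq_add_neg]
      _ = (-1 : R) ^ (k + 2) • contractLeft d (X * ExteriorAlgebra.ι R m) := by
        rw [contractLeft_mul_of_mem hX, contractLeft_ι, smul_add, smul_smul, sign, one_smul,
          ← Algebra.commutes, ← Algebra.smul_def, add_comm]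

theorem map_contractLeft (f : M →ₗ[R] N) (d : Dual R N) (X : ExteriorAlgebra R M) :
    ExteriorAlgebra.map f (contractLeft (d ∘ₗ f) X) =
      contractLeft d (ExteriorAlgebra.map f X) := by
  induction X using CliffordAlgebra.left_induction with
  | algebraMap r => simp
  | add X Y hX hY => simp only [map_add, hX, hY]
  | ι_mul X a hX =>
    rw [contractLeft_ι_mul, map_sub, map_smul, map_mul, hX, map_mul,
      show ExteriorAlgebra.map f (CliffordAlgebra.ι 0 a) = CliffordAlgebra.ι 0 (f a) from
        ExteriorAlgebra.map_apply_ι f a, contractLeft_ι_mul]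
    rfl

instance [Module.Free R M] [Module.Finite R M] : Module.Finite R (ExteriorAlgebra R M) := by
  classical
  obtain ⟨_, _⟩ := exists_wellFoundedLT (Free.ChooseBasisIndex R M)
  exact .of_basis (Free.chooseBasis R M).ExteriorAlgebra

end ExteriorAlgebra

/-- The algebra `Λ(T^* ⊕ W)` of forms on `T` with values in `ΛW`, of which `FormFibre` is the case
of a fibre of the bundle. -/
abbrev MixedExterior (R T W : Type*) [CommRing R] [AddCommGroup T] [Module R T] [AddCommGroup W]
    [Module R W] : Type _ :=
  ExteriorAlgebra R (Dual R T × W)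

namespace MixedExterior

open ExteriorAlgebra CliffordAlgebra

variable {R T W : Type*} [CommRing R] [AddCommGroup T] [Module R T] [AddCommGroup W] [Module R W]

/-- The inclusion of the covectors, as the elements of bidegree `(1, 0)`. -/
def ofDual : Dual R T →ₗ[R] MixedExterior R T W :=
  ExteriorAlgebra.ι R ∘ₗ LinearMap.inl R _ _

/-- The inclusion of the internal vectors, as the elements of bidegree `(0, 1)`. -/
def ofVec : W →ₗ[R] MixedExterior R T W :=
  ExteriorAlgebra.ι R ∘ₗ LinearMap.inr R _ _

variable (R T W) in
/-- The elements with `i` form indices and `j` internal indices. -/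
def bideg (i j : ℕ) : Submodule R (MixedExterior R T W) :=
  LinearMap.range (ofDual (W := W)) ^ i * LinearMap.range (ofVec (T := T)) ^ j

/-- The interior product with a vector of `T`, which removes the first form index. -/
def interior : T →ₗ[R] MixedExterior R T W →ₗ[R] MixedExterior R T W :=
  contractLeft ∘ₗ (LinearMap.fst R _ _).dualMap ∘ₗ Dual.eval R T

/-- The contraction of the first internal index with a covector of `W`. -/
def contract : Dual R W →ₗ[R] MixedExterior R T W →ₗ[R] MixedExterior R T W :=
  contractLeft ∘ₗ (LinearMap.snd R _ _).dualMap

section Contractions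

theorem interior_ofDual_mul (u : T) (ξ : Dual R T) (X : MixedExterior R T W) :
    interior u (ofDual ξ * X) = ξ u • X - ofDual ξ * interior u X :=
  contractLeft_ι_mul _ _ _

theorem interior_ofVec_mul (u : T) (w : W) (X : MixedExterior R T W) :
    interior u (ofVec w * X) = -(ofVec w * interior u X) :=
  (contractLeft_ι_mul _ _ _).trans (by simp [ofVec, interior, LinearMap.dualMap_apply'])

theorem contract_ofDual_mul (d : Dual R W) (ξ : Dual R T) (X : MixedExterior R T W) :
    contract d (ofDual ξ * X) = -(ofDual ξ * contract d X) :=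
  (contractLeft_ι_mul _ _ _).trans (by simp [ofDual, contract, LinearMap.dualMap_apply'])

theorem contract_ofVec_mul (d : Dual R W) (w : W) (X : MixedExterior R T W) :
    contract d (ofVec w * X) = d w • X - ofVec w * contract d X :=
  contractLeft_ι_mul _ _ _

end Contractions

section Bidegree

theorem bideg_mul (i j k l : ℕ) :
    bideg R T W i j * bideg R T W k l = bideg R T W (i + k) (j + l) := by
  rw [bideg, bideg, bideg, pow_add, pow_add]
  exact ((commute_range_ι_comp _ _).pow_pow j k).mul_mul_mul_comm _ _

theorem mul_mem_bideg {i j k l : ℕ} {X Y : MixedExterior R T W} (hX : X ∈ bideg R T W i j)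
    (hY : Y ∈ bideg R T W k l) : X * Y ∈ bideg R T W (i + k) (j + l) := by
  rw [← bideg_mul]
  exact Submodule.mul_mem_mul hX hY

theorem ofDual_mem_bideg (ξ : Dual R T) : (ofDual ξ : MixedExterior R T W) ∈ bideg R T W 1 0 := by
  simp [bideg]

theorem ofVec_mem_bideg (w : W) : (ofVec w : MixedExterior R T W) ∈ bideg R T W 0 1 := by
  simp [bideg]

theorem bideg_le_exteriorPower (i j : ℕ) : bideg R T W i j ≤ ⋀[R]^(i + j) (Dual R T × W) := by
  rw [exteriorPower, pow_add]
  exact mul_le_mul' (range_ι_comp_pow_le _ i) (range_ι_comp_pow_le _ j)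

theorem interior_mem_bideg (u : T) {i j : ℕ} {X : MixedExterior R T W}
    (hX : X ∈ bideg R T W (i + 1) j) : interior u X ∈ bideg R T W i j := by
  induction hX using Submodule.mul_induction_on' with
  | add X _ Y _ hX hY => rw [map_add]; exact Submodule.add_mem _ hX hY
  | mem_mul_mem A hA B hB =>
    have hB' : interior u B = 0 := contractLeft_eq_zero_of_mem_pow (by ext; simp) hB
    have leibniz : interior u (A * B) =
        interior u A * B + (-1 : R) ^ (i + 1) • (A * interior u B) :=
      contractLeft_mul_of_mem (range_ι_comp_pow_le _ _ hA) _ B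
    rw [leibniz, hB', mul_zero, smul_zero, add_zero]
    exact Submodule.mul_mem_mul (contractLeft_mem_pow _ _ hA) hB

theorem contract_mem_bideg (d : Dual R W) {i j : ℕ} {X : MixedExterior R T W}
    (hX : X ∈ bideg R T W i (j + 1)) : contract d X ∈ bideg R T W i j := by
  induction hX using Submodule.mul_induction_on' with
  | add X _ Y _ hX hY => rw [map_add]; exact Submodule.add_mem _ hX hY
  | mem_mul_mem A hA B hB =>
    have hA' : contract d A = 0 := contractLeft_eq_zero_of_mem_pow (by ext; simp) hA
    have leibniz : contract d (A * B) = contract d A * B + (-1 : R) ^ i • (A * contract d B) :=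
      contractLeft_mul_of_mem (range_ι_comp_pow_le _ _ hA) _ B
    rw [leibniz, hA', zero_mul, zero_add]
    exact Submodule.smul_mem _ _ (Submodule.mul_mem_mul hA (contractLeft_mem_pow _ _ hB))

theorem contract_eq_zero_of_mem_bideg (d : Dual R W) {i : ℕ} {X : MixedExterior R T W}
    (hX : X ∈ bideg R T W i 0) : contract d X = 0 := by
  rw [bideg, pow_zero, mul_one] at hX
  exact contractLeft_eq_zero_of_mem_pow (by ext; simp) hX

end Bidegree

section Coframe

variable {κ : Type*} [Fintype κ] (b : Basis κ R T) (e : T →ₗ[R] W)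

/-- A linear map `e : T → W` as an element of bidegree `(1, 1)`; it does not depend on `b`. -/
def coframe : MixedExterior R T W := ∑ μ, ofDual (b.coord μ) * ofVec (e (b μ))

theorem coframe_mem_bideg : coframe b e ∈ bideg R T W 1 1 :=
  Submodule.sum_mem _ fun _ _ ↦
    mul_mem_bideg (i := 1) (j := 0) (k := 0) (l := 1) (ofDual_mem_bideg _) (ofVec_mem_bideg _)

theorem coframe_pow_mem_bideg (k : ℕ) : coframe b e ^ k ∈ bideg R T W k k := by
  induction k with
  | zero => simp [bideg]
  | succ k ih => rw [pow_succ]; exact mul_mem_bideg ih (coframe_mem_bideg b e)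

theorem commute_coframe (X : MixedExterior R T W) : Commute (coframe b e) X :=
  Commute.sum_left _ _ _ fun _ _ ↦ commute_ι_mul_ι _ _ _

theorem isNilpotent_coframe : IsNilpotent (coframe b e) := by
  refine Commute.isNilpotent_sum (fun μ _ ↦ ⟨2, ?_⟩) fun _ _ _ _ ↦ commute_ι_mul_ι _ _ _
  have swap : ofVec (e (b μ)) * ofDual (b.coord μ) = -(ofDual (b.coord μ) * ofVec (e (b μ))) :=
    ι_mul_ι_comm _ _
  have square : ofVec (e (b μ)) * ofVec (e (b μ)) = (0 : MixedExterior R T W) := ι_sq_zero _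
  rw [sq, mul_assoc, ← mul_assoc (ofVec _), swap, neg_mul, mul_assoc, square, mul_zero, neg_zero,
    mul_zero]

theorem interior_coframe_mul (u : T) (X : MixedExterior R T W) :
    interior u (coframe b e * X) = ofVec (e u) * X + coframe b e * interior u X := by
  have expand : ofVec (e u) = ∑ μ, b.coord μ u • (ofVec (e (b μ)) : MixedExterior R T W) := by
    simp_rw [← map_smul, ← map_sum, Basis.coord_apply, b.sum_repr]
  simp only [expand, coframe, Finset.sum_mul, map_sum, mul_assoc, interior_ofDual_mul,
    interior_ofVec_mul, mul_neg, sub_neg_eq_add, Finset.sum_add_distrib, smul_mul_assoc]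

theorem contract_coframe_mul (d : Dual R W) (X : MixedExterior R T W) :
    contract d (coframe b e * X) = -(ofDual (d ∘ₗ e) * X) + coframe b e * contract d X := by
  have expand : ofDual (d ∘ₗ e) =
      ∑ μ, d (e (b μ)) • (ofDual (b.coord μ) : MixedExterior R T W) := by
    simp_rw [← map_smul, ← map_sum, ← LinearMap.comp_apply, b.sum_dual_apply_smul_coord]
  simp only [expand, coframe, Finset.sum_mul, map_sum, mul_assoc, contract_ofDual_mul,
    contract_ofVec_mul, mul_sub, neg_sub, Finset.sum_sub_distrib, smul_mul_assoc, mul_smul_comm]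
  abel

theorem contract_coframe_pow_mul {d : Dual R W} (hd : d ∘ₗ e = 0) (k : ℕ)
    (X : MixedExterior R T W) :
    contract d (coframe b e ^ k * X) = coframe b e ^ k * contract d X := by
  induction k with
  | zero => rw [pow_zero, one_mul, one_mul]
  | succ k ih =>
    rw [pow_succ', mul_assoc, contract_coframe_mul, hd, map_zero, zero_mul, neg_zero, zero_add, ih,
      mul_assoc]

end Coframe

section Trace

variable {κ : Type*} [Fintype κ] (b : Basis κ R T) (e : T →ₗ[R] W) (r : W →ₗ[R] T)

/-- The trace `∑_μ ι_{∂_μ} ι_{e^μ}` over one form index and one internal index, with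
`e^μ = dx^μ ∘ r`; the lowering operator of the Lefschetz pair `(coframe, trace)`. -/
def trace : MixedExterior R T W →ₗ[R] MixedExterior R T W :=
  ∑ μ, contract (b.coord μ ∘ₗ r) ∘ₗ interior (b μ)

theorem trace_apply (X : MixedExterior R T W) :
    trace b r X = ∑ μ, contract (b.coord μ ∘ₗ r) (interior (b μ) X) := by
  simp only [trace, LinearMap.sum_apply, LinearMap.comp_apply]

theorem trace_mem_bideg {i j : ℕ} {X : MixedExterior R T W}
    (hX : X ∈ bideg R T W (i + 1) (j + 1)) : trace b r X ∈ bideg R T W i j := by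
  rw [trace_apply]
  exact Submodule.sum_mem _ fun _ _ ↦ contract_mem_bideg _ (interior_mem_bideg _ hX)

theorem trace_eq_zero_of_mem_bideg {i : ℕ} {X : MixedExterior R T W}
    (hX : X ∈ bideg R T W i 0) : trace b r X = 0 := by
  have anticomm (μ) : contract (b.coord μ ∘ₗ r) (interior (b μ) X) =
      -interior (b μ) (contract (b.coord μ ∘ₗ r) X) := contractLeft_comm _ _ _
  simp only [trace_apply, anticomm, contract_eq_zero_of_mem_bideg _ hX, map_zero, neg_zero,
    Finset.sum_const_zero]

/-- A decomposition `W = e(T) ⊕ R n`, given by its projection to `T` and its coordinate along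
`n`. -/
structure Splitting (e : T →ₗ[R] W) (n : W) where
  proj : W →ₗ[R] T
  coord : Dual R W
  proj_comp : proj ∘ₗ e = LinearMap.id
  coord_comp : coord ∘ₗ e = 0
  coord_self : coord n = 1
  decomp (w : W) : e (proj w) + coord w • n = w

/-- The splitting whose inverse is a given isomorphism `(u, t) ↦ e u + t n`. -/
def Splitting.ofEquiv {e : T →ₗ[R] W} {n : W} (Φ : (T × R) ≃ₗ[R] W)
    (hΦ : ∀ p, Φ p = e p.1 + p.2 • n) : Splitting e n where
  proj := LinearMap.fst R T R ∘ₗ Φ.symm.toLinearMap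
  coord := LinearMap.snd R T R ∘ₗ Φ.symm.toLinearMap
  proj_comp := by
    ext u
    simp [show Φ.symm (e u) = (u, 0) by simp [LinearEquiv.symm_apply_eq, hΦ]]
  coord_comp := by
    ext u
    simp [show Φ.symm (e u) = (u, 0) by simp [LinearEquiv.symm_apply_eq, hΦ]]
  coord_self := by simp [show Φ.symm n = (0, 1) by simp [LinearEquiv.symm_apply_eq, hΦ]]
  decomp w := (hΦ (Φ.symm w)).symm.trans (Φ.apply_symm_apply w)

variable {b e} {n : W}

/-- Euler's identity for the basis `(dx^μ, e_μ, n)` of `T^* ⊕ W`. -/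
theorem Splitting.sum_add_ofVec_mul_contract (s : Splitting e n) {d : ℕ}
    {X : MixedExterior R T W} (hX : X ∈ ⋀[R]^d (Dual R T × W)) :
    ∑ μ, ofDual (b.coord μ) * interior (b μ) X +
        ∑ μ, ofVec (e (b μ)) * contract (b.coord μ ∘ₗ s.proj) X + ofVec n * contract s.coord X =
      (d : R) • X := by
  let v : κ ⊕ κ ⊕ Unit → Dual R T × W := Sum.elim (fun μ ↦ (b.coord μ, 0))
    (Sum.elim (fun μ ↦ (0, e (b μ))) fun _ ↦ (0, n))
  let δ : κ ⊕ κ ⊕ Unit → Dual R (Dual R T × W) :=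
    Sum.elim (fun μ ↦ Dual.eval R T (b μ) ∘ₗ LinearMap.fst R _ _)
      (Sum.elim (fun μ ↦ (b.coord μ ∘ₗ s.proj) ∘ₗ LinearMap.snd R _ _)
        fun _ ↦ s.coord ∘ₗ LinearMap.snd R _ _)
  have resolution (a : Dual R T × W) : ∑ i, δ i a • v i = a := by
    have hw : ∑ μ, b.repr (s.proj a.2) μ • e (b μ) + s.coord a.2 • n = a.2 := by
      simp_rw [← map_smul, ← map_sum, b.sum_repr, s.decomp]
    ext1 <;> simp [v, δ, Fintype.sum_sum_type, Prod.fst_sum, Prod.snd_sum, hw,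
      b.sum_dual_apply_smul_coord]
  have euler := sum_ι_mul_contractLeft (f := LinearMap.id) resolution (k := d) (Y := 1) hX
    fun _ ↦ contractLeft_one _ _
  simp only [mul_one, Fintype.sum_sum_type, Fintype.sum_unique, ← add_assoc] at euler
  exact euler

theorem Splitting.trace_coframe_mul (s : Splitting e n) {d : ℕ} {X : MixedExterior R T W}
    (hX : X ∈ ⋀[R]^d (Dual R T × W)) :
    trace b s.proj (coframe b e * X) = coframe b e * trace b s.proj X +
      ((Fintype.card κ : R) - d) • X + ofVec n * contract s.coord X := by
  have hcomp (μ) : (b.coord μ ∘ₗ s.proj) ∘ₗ e = b.coord μ := by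
    rw [LinearMap.comp_assoc, s.proj_comp, LinearMap.comp_id]
  have hone (μ) : b.coord μ (s.proj (e (b μ))) = 1 := by
    rw [← LinearMap.comp_apply, ← LinearMap.comp_apply, hcomp, Basis.coord_apply,
      Basis.repr_self, Finsupp.single_eq_same]
  rw [sub_smul, ← s.sum_add_ofVec_mul_contract (b := b) hX]
  simp only [trace_apply, interior_coframe_mul, map_add, contract_ofVec_mul, contract_coframe_mul,
    hcomp, LinearMap.comp_apply, hone, one_smul, Finset.sum_add_distrib, Finset.sum_sub_distrib,
    Finset.sum_neg_distrib, Finset.mul_sum, Finset.sum_const, Finset.card_univ,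
    Nat.cast_smul_eq_nsmul]
  abel

end Trace

open ExteriorAlgebra CliffordAlgebra

section Primitive

variable {R T W : Type*} [CommRing R] [AddCommGroup T] [Module R T] [AddCommGroup W]
  [Module R W] {κ : Type*} [Fintype κ] {b : Basis κ R T} {e : T →ₗ[R] W} {n : W}
  (s : Splitting e n)

theorem coframe_pow_mul_mem_exteriorPower {d : ℕ} {X : MixedExterior R T W}
    (hX : X ∈ ⋀[R]^d (Dual R T × W)) (k : ℕ) :
    coframe b e ^ k * X ∈ ⋀[R]^(2 * k + d) (Dual R T × W) := by
  rw [exteriorPower, pow_add, two_mul]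
  exact Submodule.mul_mem_mul (bideg_le_exteriorPower k k (coframe_pow_mem_bideg b e k)) hX

theorem Splitting.trace_coframe_pow_mul {d : ℕ} {X : MixedExterior R T W}
    (hX : X ∈ ⋀[R]^d (Dual R T × W)) (hn : contract s.coord X = 0) (k : ℕ) :
    trace b s.proj (coframe b e ^ (k + 1) * X) = coframe b e ^ (k + 1) * trace b s.proj X +
      ((k + 1) * ((Fintype.card κ : R) - d - k)) • (coframe b e ^ k * X) := by
  induction k with
  | zero => simp [s.trace_coframe_mul hX, hn]
  | succ k ih =>
    rw [pow_succ' _ (k + 1), mul_assoc,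
      s.trace_coframe_mul (coframe_pow_mul_mem_exteriorPower hX (k + 1)), ih,
      contract_coframe_pow_mul b e s.coord_comp, hn, mul_zero, mul_zero, add_zero, mul_add,
      mul_smul_comm, ← mul_assoc, ← mul_assoc, ← pow_succ', ← pow_succ', add_assoc, ← add_smul]
    congr 2
    push_cast
    ring

theorem contract_mul_ofVec (d : Dual R W) {i : ℕ} {B : MixedExterior R T W}
    (hB : B ∈ bideg R T W i 0) (w : W) :
    contract d (B * ofVec w) = ((-1) ^ i * d w) • B := by
  have leibniz : contract d (B * ofVec w) =
      contract d B * ofVec w + (-1 : R) ^ i • (B * contract d (ofVec w)) :=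
    contractLeft_mul_of_mem (bideg_le_exteriorPower i 0 hB) _ _
  have value : contract d (ofVec w : MixedExterior R T W) = algebraMap R _ (d w) :=
    contractLeft_ι _ _ _
  rw [leibniz, contract_eq_zero_of_mem_bideg d hB, zero_mul, zero_add, value, ← Algebra.commutes,
    ← Algebra.smul_def, smul_smul]

theorem Splitting.contract_coframe_mul_eq_zero {X : MixedExterior R T W} {i : ℕ}
    (hX : X ∈ bideg R T W i 0) : contract s.coord (coframe b e * X) = 0 := by
  rw [contract_coframe_mul, s.coord_comp, map_zero, contract_eq_zero_of_mem_bideg _ hX, mul_zero,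
    zero_mul, neg_zero, zero_add]

theorem Splitting.trace_coframe_mul_of_mem_bideg {X : MixedExterior R T W} {i : ℕ}
    (hX : X ∈ bideg R T W i 0) :
    trace b s.proj (coframe b e * X) = ((Fintype.card κ : R) - i) • X := by
  rw [s.trace_coframe_mul (bideg_le_exteriorPower i 0 hX), trace_eq_zero_of_mem_bideg _ _ hX,
    contract_eq_zero_of_mem_bideg _ hX, mul_zero, mul_zero, zero_add, add_zero, add_zero]

variable (b) in
/-- The primitive elements of the Lefschetz decomposition, annihilated by the lowering operator
`trace` and by the contraction with the covector dual to `n`. -/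
def Splitting.IsPrimitive (X : MixedExterior R T W) : Prop :=
  contract s.coord X = 0 ∧ trace b s.proj X = 0

variable {s}

theorem isPrimitive_of_mem_bideg {i : ℕ} {X : MixedExterior R T W} (hX : X ∈ bideg R T W i 0) :
    s.IsPrimitive b X :=
  ⟨contract_eq_zero_of_mem_bideg _ hX, trace_eq_zero_of_mem_bideg b _ hX⟩

namespace Splitting.IsPrimitive

theorem trace_coframe_pow_mul {d : ℕ} {X : MixedExterior R T W} (hp : s.IsPrimitive b X)
    (hX : X ∈ ⋀[R]^d (Dual R T × W)) (k : ℕ) :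
    trace b s.proj (coframe b e ^ (k + 1) * X) =
      ((k + 1) * ((Fintype.card κ : R) - d - k)) • (coframe b e ^ k * X) := by
  rw [s.trace_coframe_pow_mul hX hp.1, hp.2, mul_zero, zero_add]

end Splitting.IsPrimitive

end Primitive

section Lefschetz

variable {K T W : Type*} [Field K] [AddCommGroup T] [Module K T] [AddCommGroup W]
  [Module K W] {κ : Type*} [Fintype κ] {b : Basis κ K T} {e : T →ₗ[K] W} {n : W}
  {s : Splitting e n}

variable (b s) in
/-- The covector `ξ` of the decomposition `Y = Z + e ξ + B n` of an element of bidegree `(2, 1)`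
into a primitive part `Z` and its complement; the two-form is `B = contract s.coord Y`. -/
def Splitting.dualPart (Y : MixedExterior K T W) : MixedExterior K T W :=
  ((Fintype.card κ : K) - 1)⁻¹ • trace b s.proj (Y - contract s.coord Y * ofVec n)

theorem Splitting.dualPart_mem_bideg {Y : MixedExterior K T W} (hY : Y ∈ bideg K T W 2 1) :
    s.dualPart b Y ∈ bideg K T W 1 0 :=
  Submodule.smul_mem _ _ <| trace_mem_bideg _ _ <| Submodule.sub_mem _ hY <|
    mul_mem_bideg (k := 0) (l := 1) (contract_mem_bideg _ hY) (ofVec_mem_bideg n)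

variable [CharZero K]

theorem lefschetz_coeff_ne_zero {m d k : ℕ} (h : m ≠ k + d) :
    ((k : K) + 1) * ((m : K) - d - k) ≠ 0 := by
  refine mul_ne_zero (Nat.cast_add_one_ne_zero k) ?_
  rw [sub_sub, ← Nat.cast_add, add_comm d]
  exact sub_ne_zero.mpr (Nat.cast_injective.ne h)

namespace Splitting.IsPrimitive

theorem eq_zero_of_coframe_pow_mul_eq_zero {d : ℕ} {X : MixedExterior K T W}
    (hp : s.IsPrimitive b X) (hX : X ∈ ⋀[K]^d (Dual K T × W)) {k : ℕ}
    (hk : k + d ≤ Fintype.card κ) (h : coframe b e ^ k * X = 0) : X = 0 := by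
  induction k with
  | zero => simpa only [pow_zero, one_mul] using h
  | succ k ih =>
    have coeff : ((k : K) + 1) * ((Fintype.card κ : K) - d - k) ≠ 0 :=
      lefschetz_coeff_ne_zero (by omega)
    refine ih (by omega) ((smul_eq_zero_iff_right coeff).mp ?_)
    rw [← hp.trace_coframe_pow_mul hX, h, map_zero]

theorem coframe_pow_mul_eq_zero {d : ℕ} {X : MixedExterior K T W}
    (hp : s.IsPrimitive b X) (hX : X ∈ ⋀[K]^d (Dual K T × W)) {k : ℕ}
    (hk : Fintype.card κ < k + d) : coframe b e ^ k * X = 0 := by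
  obtain ⟨l, hl⟩ := isNilpotent_coframe b e
  have vanish : coframe b e ^ (k + l) * X = 0 := by rw [pow_add, hl, mul_zero, zero_mul]
  clear hl
  induction l with
  | zero => exact vanish
  | succ l ih =>
    have coeff : ((k + l : ℕ) + 1) * ((Fintype.card κ : K) - d - (k + l : ℕ)) ≠ 0 :=
      lefschetz_coeff_ne_zero (by omega)
    refine ih ((smul_eq_zero_iff_right coeff).mp ?_)
    rw [← hp.trace_coframe_pow_mul hX, add_assoc, vanish, map_zero]

end Splitting.IsPrimitive

theorem eq_zero_of_coframe_pow_mul_of_mem_bideg (s : Splitting e n) {i k : ℕ}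
    (hk : k + i ≤ Fintype.card κ) {X : MixedExterior K T W} (hX : X ∈ bideg K T W i 0)
    (h : coframe b e ^ k * X = 0) : X = 0 :=
  (isPrimitive_of_mem_bideg (s := s) hX).eq_zero_of_coframe_pow_mul_eq_zero
    (bideg_le_exteriorPower i 0 hX) hk h

theorem trace_eq_zero_of_coframe_pow_mul_eq_zero {k : ℕ} (hk : k + 2 = Fintype.card κ)
    {Y : MixedExterior K T W} (hY : Y ∈ bideg K T W 2 1) (hn : contract s.coord Y = 0)
    (h : coframe b e ^ k * Y = 0) : trace b s.proj Y = 0 := by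
  cases k with
  | zero => rw [← one_mul Y, ← pow_zero, h, map_zero]
  | succ k =>
    have coeff : (Fintype.card κ : K) - (2 + 1 : ℕ) - k = 0 := by
      rw [← hk]
      push_cast
      ring
    have kernel := s.trace_coframe_pow_mul (b := b) (bideg_le_exteriorPower 2 1 hY) hn k
    rw [coeff, mul_zero, zero_smul, add_zero, h, map_zero] at kernel
    exact eq_zero_of_coframe_pow_mul_of_mem_bideg s (by omega) (trace_mem_bideg b _ hY) kernel.symm

theorem coframe_pow_mul_eq_zero_iff_isPrimitive {k : ℕ} (hk : k + 2 = Fintype.card κ)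
    {Y : MixedExterior K T W} (hY : Y ∈ bideg K T W 2 1) :
    coframe b e ^ k * Y = 0 ↔ s.IsPrimitive b Y := by
  refine ⟨fun h ↦ ?_, fun h ↦ h.coframe_pow_mul_eq_zero (bideg_le_exteriorPower 2 1 hY) (by omega)⟩
  have hn : contract s.coord Y = 0 :=
    eq_zero_of_coframe_pow_mul_of_mem_bideg (b := b) s hk.le (contract_mem_bideg _ hY) <| by
      rw [← contract_coframe_pow_mul b e s.coord_comp, h, map_zero]
  exact ⟨hn, trace_eq_zero_of_coframe_pow_mul_eq_zero hk hY hn h⟩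

theorem Splitting.isPrimitive_sub (hκ : Fintype.card κ ≠ 1) {Y : MixedExterior K T W}
    (hY : Y ∈ bideg K T W 2 1) :
    s.IsPrimitive b
      (Y - (coframe b e * s.dualPart b Y + contract s.coord Y * ofVec n)) := by
  have hB := contract_mem_bideg s.coord hY
  have hξ := s.dualPart_mem_bideg (b := b) hY
  constructor
  · rw [map_sub, map_add, s.contract_coframe_mul_eq_zero hξ, contract_mul_ofVec _ hB, s.coord_self,
      zero_add, mul_one, neg_one_sq, one_smul, sub_self]
  · have hκ' : (Fintype.card κ : K) - 1 ≠ 0 := sub_ne_zero.mpr (Nat.cast_ne_one.mpr hκ)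
    rw [add_comm, ← sub_sub, map_sub, s.trace_coframe_mul_of_mem_bideg hξ, Splitting.dualPart,
      Nat.cast_one, smul_smul, mul_inv_cancel₀ hκ', one_smul, sub_self]

theorem Splitting.IsPrimitive.coframe_mul_add_mul_ofVec_eq_zero (hκ : Fintype.card κ ≠ 1)
    {ξ B : MixedExterior K T W} (hξ : ξ ∈ bideg K T W 1 0) (hB : B ∈ bideg K T W 2 0)
    (hp : s.IsPrimitive b (coframe b e * ξ + B * ofVec n)) :
    coframe b e * ξ + B * ofVec n = 0 := by
  obtain ⟨hn, ht⟩ := hp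
  rw [map_add, s.contract_coframe_mul_eq_zero hξ, contract_mul_ofVec _ hB, s.coord_self, zero_add,
    mul_one, neg_one_sq, one_smul] at hn
  have hκ' : (Fintype.card κ : K) - (1 : ℕ) ≠ 0 := sub_ne_zero.mpr (Nat.cast_injective.ne hκ)
  rw [hn, zero_mul, add_zero, s.trace_coframe_mul_of_mem_bideg hξ, smul_eq_zero_iff_right hκ'] at ht
  rw [hn, ht, mul_zero, zero_mul, add_zero]

theorem Splitting.IsPrimitive.eq_zero_of_ofVec_mul_eq {k : ℕ} (hk : k + 3 = Fintype.card κ)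
    {X Y : MixedExterior K T W} (hX : X ∈ bideg K T W 1 1) (hY : Y ∈ bideg K T W 2 1)
    (hp : s.IsPrimitive b Y)
    (h : ofVec n * (coframe b e ^ k * Y) = coframe b e ^ (k + 1) * X) : Y = 0 := by
  have hY' := bideg_le_exteriorPower 2 1 hY
  have hξ := contract_mem_bideg s.coord hX
  have contracted : coframe b e ^ k * Y = coframe b e ^ (k + 1) * contract s.coord X := by
    have := congrArg (contract s.coord) h
    rwa [contract_ofVec_mul, s.coord_self, one_smul, contract_coframe_pow_mul b e s.coord_comp,
      contract_coframe_pow_mul b e s.coord_comp, hp.1, mul_zero, mul_zero, sub_zero] at this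
  have coeff_zero : contract s.coord X = 0 := by
    refine eq_zero_of_coframe_pow_mul_of_mem_bideg (b := b) (k := k + 2) s (by omega) hξ ?_
    rw [pow_succ', mul_assoc, ← contracted, ← mul_assoc, ← pow_succ']
    exact hp.coframe_pow_mul_eq_zero hY' (by omega)
  rw [coeff_zero, mul_zero] at contracted
  exact hp.eq_zero_of_coframe_pow_mul_eq_zero hY' hk.le contracted

end Lefschetz

section Values

variable {R T W : Type*} [CommRing R] [AddCommGroup T] [Module R T] [AddCommGroup W] [Module R W]

theorem exists_ofDual_eq {X : MixedExterior R T W} (hX : X ∈ bideg R T W 1 0) :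
    ∃ ξ, ofDual ξ = X := by
  simpa [bideg] using hX

theorem exists_algebraMap_eq {X : MixedExterior R T W} (hX : X ∈ bideg R T W 0 0) :
    ∃ c, algebraMap R _ c = X := by
  simpa [bideg, Submodule.mem_one] using hX

theorem interior_eq_zero_of_mem_bideg (u : T) {j : ℕ} {X : MixedExterior R T W}
    (hX : X ∈ bideg R T W 0 j) : interior u X = 0 := by
  rw [bideg, pow_zero, one_mul] at hX
  exact contractLeft_eq_zero_of_mem_pow (by ext; simp) hX

theorem interior_mul_ofVec (u : T) {d : ℕ} {X : MixedExterior R T W}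
    (hX : X ∈ ⋀[R]^d (Dual R T × W)) (w : W) :
    interior u (X * ofVec w) = interior u X * ofVec w := by
  have leibniz : interior u (X * ofVec w) =
      interior u X * ofVec w + (-1 : R) ^ d • (X * interior u (ofVec w)) :=
    contractLeft_mul_of_mem hX _ _
  rw [leibniz, interior_eq_zero_of_mem_bideg u (ofVec_mem_bideg w), mul_zero, smul_zero, add_zero]

theorem interior_comm (u w : T) (X : MixedExterior R T W) :
    interior w (interior u X) = -interior u (interior w X) :=
  contractLeft_comm _ _ _

theorem contract_interior (d : Dual R W) (u : T) (X : MixedExterior R T W) :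
    contract d (interior u X) = -interior u (contract d X) :=
  contractLeft_comm _ _ _

theorem sum_ofDual_mul_interior {κ : Type*} [Fintype κ] (b : Basis κ R T) {i j : ℕ}
    {X : MixedExterior R T W} (hX : X ∈ bideg R T W i j) :
    ∑ μ, ofDual (b.coord μ) * interior (b μ) X = (i : R) • X := by
  induction hX using Submodule.mul_induction_on' with
  | add X _ Y _ hX hY => simp only [map_add, mul_add, Finset.sum_add_distrib, hX, hY, smul_add]
  | mem_mul_mem A hA B hB =>
    have resolution (ξ : Dual R T) :
        ∑ μ, (Dual.eval R T (b μ) ∘ₗ LinearMap.fst R _ W) (LinearMap.inl R _ W ξ) •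
          ((b.coord μ, 0) : Dual R T × W) = LinearMap.inl R _ W ξ := by
      ext1 <;> simp [Prod.fst_sum, Prod.snd_sum, b.sum_dual_apply_smul_coord]
    have euler := sum_ι_mul_contractLeft resolution hA (Y := B) fun μ ↦
      contractLeft_eq_zero_of_mem_pow (by ext; simp) hB
    exact euler

/-- The component of bidegree `(0, 1)`. -/
def vecComponent : MixedExterior R T W →ₗ[R] W :=
  LinearMap.snd R _ _ ∘ₗ ExteriorAlgebra.ιInv

theorem vecComponent_ofVec (w : W) : vecComponent (ofVec w : MixedExterior R T W) = w :=
  congrArg Prod.snd (ExteriorAlgebra.ι_leftInverse ((0, w) : Dual R T × W))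

theorem ofVec_vecComponent {X : MixedExterior R T W} (hX : X ∈ bideg R T W 0 1) :
    ofVec (vecComponent X) = X := by
  obtain ⟨w, rfl⟩ : ∃ w, ofVec w = X := by simpa [bideg] using hX
  rw [vecComponent_ofVec]

/-- The values `X(u, w)` of a two-form with values in `W`. -/
def value (X : MixedExterior R T W) : T →ₗ[R] T →ₗ[R] W :=
  LinearMap.mk₂ R (fun u w ↦ vecComponent (interior w (interior u X)))
    (by simp) (by simp) (by simp) (by simp)

theorem value_apply (X : MixedExterior R T W) (u w : T) :
    value X u w = vecComponent (interior w (interior u X)) := rfl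

theorem value_add (X Y : MixedExterior R T W) : value (X + Y) = value X + value Y := by
  ext; simp [value_apply]

theorem value_swap (X : MixedExterior R T W) (u w : T) : value X u w = -value X w u := by
  rw [value_apply, value_apply, interior_comm, map_neg]

theorem ofVec_value {X : MixedExterior R T W} (hX : X ∈ bideg R T W 2 1) (u w : T) :
    ofVec (value X u w) = interior w (interior u X) :=
  ofVec_vecComponent (interior_mem_bideg _ (interior_mem_bideg _ hX))

theorem algebraMap_value {X : MixedExterior R T W} (hX : X ∈ bideg R T W 2 1) (d : Dual R W)
    (u w : T) :
    algebraMap R (MixedExterior R T W) (d (value X u w)) =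
      interior w (interior u (contract d X)) := by
  have reduce : contract d (ofVec (value X u w) : MixedExterior R T W) =
      algebraMap R _ (d (value X u w)) := contractLeft_ι _ _ _
  rw [← reduce, ofVec_value hX, contract_interior, contract_interior, map_neg, neg_neg]

theorem value_mul_ofVec_mem_span {B : MixedExterior R T W} (hB : B ∈ bideg R T W 2 0) (n : W)
    (u w : T) : value (B * ofVec n) u w ∈ R ∙ n := by
  have hB' := interior_mem_bideg u hB
  obtain ⟨c, hc⟩ := exists_algebraMap_eq (interior_mem_bideg w hB')
  rw [value_apply, interior_mul_ofVec u (bideg_le_exteriorPower 2 0 hB),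
    interior_mul_ofVec w (bideg_le_exteriorPower 1 0 hB'), ← hc, ← Algebra.smul_def, map_smul,
    vecComponent_ofVec]
  exact Submodule.smul_mem _ _ (Submodule.mem_span_singleton_self n)

theorem value_coframe_mul {κ : Type*} [Fintype κ] (b : Basis κ R T) (e : T →ₗ[R] W)
    (ξ : Dual R T) (u w : T) :
    value (coframe b e * ofDual ξ) u w = ξ u • e w - ξ w • e u := by
  have evaluate (v : T) : interior v (ofDual ξ : MixedExterior R T W) = algebraMap R _ (ξ v) :=
    contractLeft_ι _ _ _
  rw [value_apply, interior_coframe_mul, evaluate, ← Algebra.commutes, ← Algebra.smul_def, map_add,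
    interior_ofVec_mul, evaluate, map_smul, ← Algebra.commutes, ← Algebra.smul_def,
    ← mul_one (coframe b e), interior_coframe_mul,
    show interior w (1 : MixedExterior R T W) = 0 from contractLeft_one _ _, mul_zero, add_zero,
    mul_one, map_add, map_neg, map_smul, map_smul, vecComponent_ofVec, vecComponent_ofVec,
    neg_add_eq_sub]

end Values

section BasisIndependence

variable {R T W A : Type*} [CommRing R] [AddCommGroup T] [Module R T] [AddCommGroup W] [Module R W]
  [AddCommGroup A] [Module R A] {κ κ' : Type*} [Fintype κ] [Fintype κ'] (b : Basis κ R T)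
  (b' : Basis κ' R T)

theorem sum_coord_basis_change (B : Dual R T →ₗ[R] T →ₗ[R] A) :
    ∑ μ, B (b.coord μ) (b μ) = ∑ ν, B (b'.coord ν) (b' ν) := by
  have expand (ν : κ') : b' ν = ∑ μ, b.coord μ (b' ν) • b μ := (b.sum_repr (b' ν)).symm
  calc ∑ μ, B (b.coord μ) (b μ)
      = ∑ μ, ∑ ν, b.coord μ (b' ν) • B (b'.coord ν) (b μ) := by
        refine Finset.sum_congr rfl fun μ _ ↦ ?_
        conv_lhs => rw [← b'.sum_dual_apply_smul_coord (b.coord μ)]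
        simp only [map_sum, map_smul, LinearMap.sum_apply, LinearMap.smul_apply]
    _ = ∑ ν, B (b'.coord ν) (b' ν) := by
        rw [Finset.sum_comm]
        refine Finset.sum_congr rfl fun ν _ ↦ ?_
        conv_rhs => rw [expand ν]
        simp only [map_sum, map_smul]

theorem coframe_basis_change (e : T →ₗ[R] W) : coframe b e = coframe b' e :=
  sum_coord_basis_change b b'
    ((LinearMap.mul R (MixedExterior R T W)).compl₁₂ ofDual (ofVec ∘ₗ e))

/-- The sum `∑_{μ,ν} dx^μ dx^ν f(∂_μ, ∂_ν)`, twice the two-form with values `f` if `f` is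
alternating. -/
def twoForm : (T →ₗ[R] T →ₗ[R] W) →ₗ[R] MixedExterior R T W where
  toFun f := ∑ μ, ∑ ν, ofDual (b.coord μ) * ofDual (b.coord ν) * ofVec (f (b μ) (b ν))
  map_add' f g := by simp [mul_add, Finset.sum_add_distrib]
  map_smul' c f := by simp [Finset.smul_sum]

theorem twoForm_apply (f : T →ₗ[R] T →ₗ[R] W) :
    twoForm b f =
      ∑ μ, ∑ ν, ofDual (b.coord μ) * ofDual (b.coord ν) * ofVec (f (b μ) (b ν)) := rfl

theorem twoForm_mem_bideg (f : T →ₗ[R] T →ₗ[R] W) : twoForm b f ∈ bideg R T W 2 1 :=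
  Submodule.sum_mem _ fun _ _ ↦ Submodule.sum_mem _ fun _ _ ↦
    mul_mem_bideg (i := 2) (j := 0) (k := 0) (l := 1)
      (mul_mem_bideg (i := 1) (j := 0) (k := 1) (l := 0) (ofDual_mem_bideg _) (ofDual_mem_bideg _))
      (ofVec_mem_bideg _)

theorem twoForm_basis_change (f : T →ₗ[R] T →ₗ[R] W) : twoForm b f = twoForm b' f := by
  have inner (u : T) : ∑ ν, (ofDual (b.coord ν) : MixedExterior R T W) * ofVec (f u (b ν)) =
      ∑ ν, ofDual (b'.coord ν) * ofVec (f u (b' ν)) :=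
    sum_coord_basis_change b b'
      ((LinearMap.mul R (MixedExterior R T W)).compl₁₂ ofDual (ofVec ∘ₗ f u))
  have outer := sum_coord_basis_change b b' (∑ ν,
    (LinearMap.mul R (MixedExterior R T W)).compl₁₂ ofDual
      (LinearMap.mulLeft R (ofDual (b'.coord ν)) ∘ₗ ofVec ∘ₗ f.flip (b' ν)))
  simp only [twoForm_apply, mul_assoc, ← Finset.mul_sum, inner]
  simpa only [LinearMap.sum_apply, LinearMap.compl₁₂_apply, LinearMap.mul_apply',
    LinearMap.comp_apply, LinearMap.mulLeft_apply, LinearMap.flip_apply, ← Finset.mul_sum]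
    using outer

theorem twoForm_value {X : MixedExterior R T W} (hX : X ∈ bideg R T W 2 1) :
    twoForm b (value X) = (2 : R) • X := by
  have inner (u : T) : ∑ ν, ofDual (b.coord ν) * interior (b ν) (interior u X) = interior u X := by
    simpa using sum_ofDual_mul_interior b (interior_mem_bideg u hX)
  simp only [twoForm_apply, ofVec_value hX, mul_assoc, ← Finset.mul_sum, inner]
  exact_mod_cast sum_ofDual_mul_interior b hX

end BasisIndependence

section Bracket

variable {R T W : Type*} [CommRing R] [AddCommGroup T] [Module R T] [AddCommGroup W] [Module R W]
  {κ : Type*} [Fintype κ] (b : Basis κ R T) (e : T →ₗ[R] W) (g : W →ₗ[R] Dual R W)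

/-- The bracket `[X, e]` for `X` of bidegree `(1, 2)`; the map `g : W → W^*` lowers an index. -/
def bracket (X : MixedExterior R T W) : MixedExterior R T W :=
  -∑ ν, ofDual (b.coord ν) * contract (g (e (b ν))) X

theorem bracket_mem_bideg {X : MixedExterior R T W} (hX : X ∈ bideg R T W 1 2) :
    bracket b e g X ∈ bideg R T W 2 1 :=
  Submodule.neg_mem _ <| Submodule.sum_mem _ fun _ _ ↦
    mul_mem_bideg (i := 1) (j := 0) (k := 1) (l := 1) (ofDual_mem_bideg _) (contract_mem_bideg _ hX)

theorem bracket_basis_change {κ' : Type*} [Fintype κ'] (b' : Basis κ' R T)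
    (X : MixedExterior R T W) : bracket b e g X = bracket b' e g X :=
  congrArg Neg.neg <| sum_coord_basis_change b b' <|
    (LinearMap.mul R (MixedExterior R T W)).compl₁₂ ofDual (contract.flip X ∘ₗ g ∘ₗ e)

theorem value_bracket {X : MixedExterior R T W} (hX : X ∈ bideg R T W 1 2) (u w : T) :
    value (bracket b e g X) u w =
      vecComponent (interior u (contract (g (e w)) X)) -
        vecComponent (interior w (contract (g (e u)) X)) := by
  have vanish (ν : κ) : interior w (interior u (contract (g (e (b ν))) X)) = 0 :=
    interior_eq_zero_of_mem_bideg w (interior_mem_bideg u (contract_mem_bideg _ hX))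
  have collect (v v' : T) :
      ∑ ν, b.coord ν v • vecComponent (interior v' (contract (g (e (b ν))) X)) =
        vecComponent (interior v' (contract (g (e v)) X)) := by
    have := congrArg (vecComponent ∘ₗ interior v' ∘ₗ contract.flip X ∘ₗ g ∘ₗ e) (b.sum_repr v)
    simpa only [map_sum, map_smul, LinearMap.comp_apply, LinearMap.flip_apply, Basis.coord_apply]
      using this
  simp only [value_apply, bracket, map_neg, map_sum, interior_ofDual_mul, map_sub, map_smul,
    vanish, mul_zero, sub_zero, Finset.sum_sub_distrib, collect, neg_sub]

theorem contract_coframe_pow_succ_mul (d : Dual R W) (k : ℕ) (X : MixedExterior R T W) :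
    contract d (coframe b e ^ (k + 1) * X) = coframe b e ^ (k + 1) * contract d X -
      (k + 1 : R) • (ofDual (d ∘ₗ e) * (coframe b e ^ k * X)) := by
  induction k with
  | zero => simp [contract_coframe_mul, sub_eq_neg_add]
  | succ k ih =>
    have swap : coframe b e * (ofDual (d ∘ₗ e) * (coframe b e ^ k * X)) =
        ofDual (d ∘ₗ e) * (coframe b e ^ (k + 1) * X) := by
      rw [(commute_coframe b e (ofDual (d ∘ₗ e))).left_comm, ← mul_assoc (coframe b e), ← pow_succ']
    rw [pow_succ' _ (k + 1), mul_assoc, contract_coframe_mul, ih, mul_sub, mul_smul_comm, swap]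
    push_cast
    rw [mul_assoc]
    module

theorem sum_ofDual_mul_ofDual_eq_zero {β : T →ₗ[R] Dual R T} (hβ : ∀ u w, β u w = β w u) :
    ∑ ν, ofDual (b.coord ν) * ofDual (β (b ν)) = (0 : MixedExterior R T W) := by
  classical
  have expand (ν : κ) : (ofDual (β (b ν)) : MixedExterior R T W) =
      ∑ μ, β (b ν) (b μ) • ofDual (b.coord μ) := by
    simp_rw [← map_smul, ← map_sum, b.sum_dual_apply_smul_coord]
  simp only [expand, Finset.mul_sum, mul_smul_comm, ← Finset.sum_product']
  refine Finset.sum_involution (fun p _ ↦ p.swap) (fun p _ ↦ ?_) (fun p _ hp diagonal ↦ hp ?_)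
    (fun _ _ ↦ Finset.mem_univ _) fun p _ ↦ p.swap_swap
  · have anticomm : ofDual (b.coord p.1) * ofDual (b.coord p.2) =
        -(ofDual (b.coord p.2) * ofDual (b.coord p.1) : MixedExterior R T W) := ι_mul_ι_comm _ _
    rw [anticomm, smul_neg, Prod.fst_swap, Prod.snd_swap, hβ, neg_add_cancel]
  · have square : ofDual (b.coord p.1) * ofDual (b.coord p.1) = (0 : MixedExterior R T W) :=
      ι_sq_zero _
    rw [show p.2 = p.1 from congrArg Prod.fst diagonal, square, smul_zero]

theorem coframe_pow_mul_bracket_eq_zero (hg : ∀ s t, g s t = g t s) {k : ℕ}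
    {X : MixedExterior R T W} (h : coframe b e ^ k * X = 0) :
    coframe b e ^ k * bracket b e g X = 0 := by
  cases k with
  | zero => rw [← one_mul X, ← pow_zero, h]; simp [bracket]
  | succ k =>
    have kernel (ν : κ) : coframe b e ^ (k + 1) * contract (g (e (b ν))) X =
        (k + 1 : R) • (ofDual (g (e (b ν)) ∘ₗ e) * (coframe b e ^ k * X)) := by
      rw [← sub_eq_zero, ← contract_coframe_pow_succ_mul, h, map_zero]
    have symmetric : ∑ ν, ofDual (b.coord ν) * ofDual (g (e (b ν)) ∘ₗ e) =
        (0 : MixedExterior R T W) :=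
      sum_ofDual_mul_ofDual_eq_zero b (β := (g ∘ₗ e).compl₂ e) fun u w ↦ hg (e u) (e w)
    simp only [bracket, mul_neg, Finset.mul_sum,
      ((commute_coframe b e _).pow_left _).left_comm, kernel, mul_smul_comm]
    rw [← Finset.smul_sum]
    simp only [← mul_assoc, ← Finset.sum_mul, symmetric, zero_mul, smul_zero, neg_zero]

end Bracket

section Orthogonality

variable {R T W : Type*} [CommRing R] [AddCommGroup T] [Module R T] [AddCommGroup W] [Module R W]
  {κ : Type*} [Fintype κ] {b : Basis κ R T} {e : T →ₗ[R] W} {n : W} {s : Splitting e n}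
  {θ : MixedExterior R T W}

namespace Splitting.IsPrimitive

theorem comp_proj_value (hp : s.IsPrimitive b θ) (hθ : θ ∈ bideg R T W 2 1) (u w : T) :
    e (s.proj (value θ u w)) = value θ u w := by
  have coord_value : s.coord (value θ u w) = 0 :=
    (algebraMap_eq_zero_iff _ _).mp (by rw [algebraMap_value hθ, hp.1, map_zero, map_zero])
  simpa [coord_value] using s.decomp (value θ u w)

theorem sum_coord_proj_value (hp : s.IsPrimitive b θ) (hθ : θ ∈ bideg R T W 2 1) (w : T) :
    ∑ μ, b.coord μ (s.proj (value θ (b μ) w)) = 0 := by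
  have traced : interior w (trace b s.proj θ) = 0 := by rw [hp.2, map_zero]
  have component (μ : κ) : interior w (contract (b.coord μ ∘ₗ s.proj) (interior (b μ) θ)) =
      -algebraMap R _ (b.coord μ (s.proj (value θ (b μ) w))) := by
    rw [contract_interior, map_neg, ← algebraMap_value hθ (b.coord μ ∘ₗ s.proj)]
    rfl
  rwa [trace_apply, map_sum, Finset.sum_congr rfl fun μ _ ↦ component μ, Finset.sum_neg_distrib,
    neg_eq_zero, ← map_sum, algebraMap_eq_zero_iff] at traced

theorem sum_inner_value_eq_zero (hp : s.IsPrimitive b θ) (hθ : θ ∈ bideg R T W 2 1)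
    (G : W →ₗ[R] W →ₗ[R] R) (hn : ∀ u, G n (e u) = 0)
    (hG : ∀ i u, G (e (b i)) (e u) = b.coord i u) {ξ B : MixedExterior R T W}
    (hξ : ξ ∈ bideg R T W 1 0) (hB : B ∈ bideg R T W 2 0) :
    ∑ i, ∑ j, G (value (coframe b e * ξ + B * ofVec n) (b i) (b j)) (value θ (b i) (b j)) = 0 := by
  obtain ⟨ξ, rfl⟩ := exists_ofDual_eq hξ
  have key (i j : κ) :
      G (value (coframe b e * ofDual ξ + B * ofVec n) (b i) (b j)) (value θ (b i) (b j)) =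
        -(ξ (b i) * b.coord j (s.proj (value θ (b j) (b i)))) -
          ξ (b j) * b.coord i (s.proj (value θ (b i) (b j))) := by
    obtain ⟨c, hc⟩ := Submodule.mem_span_singleton.mp (value_mul_ofVec_mem_span hB n (b i) (b j))
    have inner_coframe (l : κ) : G (e (b l)) (value θ (b i) (b j)) =
        b.coord l (s.proj (value θ (b i) (b j))) := by
      rw [← hG, hp.comp_proj_value hθ]
    have inner_normal : G n (value θ (b i) (b j)) = 0 := by
      rw [← hp.comp_proj_value hθ, hn]
    rw [value_add, LinearMap.add_apply, LinearMap.add_apply, value_coframe_mul, ← hc,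
      value_swap θ (b j)]
    simp only [map_add, map_sub, map_smul, map_neg, LinearMap.add_apply, LinearMap.sub_apply,
      LinearMap.smul_apply, inner_coframe, inner_normal, smul_eq_mul, mul_zero, add_zero, mul_neg,
      neg_neg]
  simp_rw [key, Finset.sum_sub_distrib, Finset.sum_neg_distrib, ← Finset.mul_sum,
    hp.sum_coord_proj_value hθ]
  rw [Finset.sum_comm]
  simp_rw [← Finset.mul_sum, hp.sum_coord_proj_value hθ]
  simp only [mul_zero, Finset.sum_const_zero, neg_zero, sub_zero]

end Splitting.IsPrimitive

end Orthogonality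

end MixedExterior

section FrameOfSplitting

variable {R T W κ : Type*} [CommRing R] [AddCommGroup T] [Module R T] [AddCommGroup W] [Module R W]
  {e : T →ₗ[R] W} {n : W}

theorem MixedExterior.Splitting.proj_self (s : Splitting e n) : s.proj n = 0 := by
  have h := congrArg s.proj (s.decomp n)
  rwa [s.coord_self, one_smul, map_add, ← LinearMap.comp_apply, s.proj_comp, LinearMap.id_apply,
    add_eq_right] at h

/-- The basis `(e b_μ, n)` of `W` obtained from a splitting and a basis `b` of `T`. -/
def MixedExterior.Splitting.basis (s : Splitting e n) (b : Basis κ R T) :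
    Basis (κ ⊕ Unit) R W :=
  (b.prod (.singleton Unit R)).map <|
    .ofLinearMap (e.coprod (LinearMap.toSpanSingleton R W n)) (s.proj.prod s.coord)
      (by ext w; simp [s.decomp])
      (by
        have h₁ (u) : s.proj (e u) = u := LinearMap.congr_fun s.proj_comp u
        have h₂ (u) : s.coord (e u) = 0 := LinearMap.congr_fun s.coord_comp u
        ext <;> simp [h₁, h₂, s.proj_self, s.coord_self])

theorem MixedExterior.Splitting.basis_inl (s : Splitting e n) (b : Basis κ R T) (μ : κ) :
    s.basis b (.inl μ) = e (b μ) := by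
  simp [basis]

theorem MixedExterior.Splitting.basis_inr (s : Splitting e n) (b : Basis κ R T) (u : Unit) :
    s.basis b (.inr u) = n := by
  simp [basis]

end FrameOfSplitting

section SplittingExistence

variable {K T W : Type*} [Field K] [AddCommGroup T] [Module K T] [AddCommGroup W] [Module K W]
  {e : T →ₗ[K] W} {n : W}

theorem coprod_toSpanSingleton_injective (he : Function.Injective e) (hn : n ∉ Set.range e) :
    Function.Injective (e.coprod (LinearMap.toSpanSingleton K W n)) := by
  have hn₀ : n ≠ 0 := fun h ↦ hn ⟨0, by rw [map_zero, h]⟩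
  rw [← LinearMap.ker_eq_bot, LinearMap.ker_coprod_of_disjoint_range, LinearMap.ker_eq_bot.mpr he,
    LinearMap.ker_toSpanSingleton K hn₀, Submodule.prod_bot]
  rwa [LinearMap.range_toSpanSingleton, Submodule.disjoint_span_singleton' hn₀]

variable [FiniteDimensional K T] [FiniteDimensional K W]

/-- The splitting of a space `W` with one dimension more than `T`, for `e` injective and `n` outside
its range. -/
def MixedExterior.Splitting.ofInjective (he : Function.Injective e) (hn : n ∉ Set.range e)
    (hd : finrank K T + 1 = finrank K W) : Splitting e n :=
  .ofEquiv (.ofInjectiveOfFinrankEq _ (coprod_toSpanSingleton_injective he hn)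
    (by rw [finrank_prod, finrank_self, hd])) fun _ ↦ rfl

end SplittingExistence

section WeakSmoothness

variable {E : Type*} [NormedAddCommGroup E] [NormedSpace ℝ E]
  {S : Type*} [TopologicalSpace S] [ChartedSpace E S]
  {A B C : Type*} [AddCommGroup A] [Module ℝ A] [AddCommGroup B] [Module ℝ B]
  [AddCommGroup C] [Module ℝ C]

variable (E) in
/-- Smoothness at a point of a map to a real vector space without a chosen norm, such as an exterior
algebra, tested on the linear functionals. -/
def WeaklySmoothAt (f : S → A) (x₀ : S) : Prop :=
  ∀ l : Dual ℝ A, ContMDiffAt 𝓘(ℝ, E) 𝓘(ℝ, ℝ) ∞ (fun x ↦ l (f x)) x₀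

variable {f : S → A} {g : S → B} {x₀ : S}

theorem weaklySmoothAt_of_contMDiffAt {F : Type*} [NormedAddCommGroup F] [NormedSpace ℝ F]
    [FiniteDimensional ℝ F] {f : S → F} (hf : ContMDiffAt 𝓘(ℝ, E) 𝓘(ℝ, F) ∞ f x₀) :
    WeaklySmoothAt E f x₀ :=
  fun l ↦ (LinearMap.toContinuousLinearMap l).contDiff.contMDiff.contMDiffAt.comp x₀ hf

namespace WeaklySmoothAt

theorem congr {f' : S → A} (hf : WeaklySmoothAt E f x₀) (h : f' =ᶠ[nhds x₀] f) :
    WeaklySmoothAt E f' x₀ :=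
  fun l ↦ (hf l).congr_of_eventuallyEq (h.fun_comp l)

theorem map (hf : WeaklySmoothAt E f x₀) (L : A →ₗ[ℝ] B) :
    WeaklySmoothAt E (fun x ↦ L (f x)) x₀ :=
  fun l ↦ hf (l ∘ₗ L)

theorem sum {ι : Type*} {s : Finset ι} {f : ι → S → A}
    (hf : ∀ i ∈ s, WeaklySmoothAt E (f i) x₀) :
    WeaklySmoothAt E (fun x ↦ ∑ i ∈ s, f i x) x₀ := fun l ↦ by
  simp only [map_sum]
  exact ContMDiffAt.sum fun i hi ↦ hf i hi l

theorem smul {c : S → ℝ} (hc : ContMDiffAt 𝓘(ℝ, E) 𝓘(ℝ, ℝ) ∞ c x₀)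
    (hf : WeaklySmoothAt E f x₀) : WeaklySmoothAt E (fun x ↦ c x • f x) x₀ := fun l ↦ by
  simp only [map_smul]
  exact hc.smul (hf l)

theorem map₂ [FiniteDimensional ℝ A] (hf : WeaklySmoothAt E f x₀) (hg : WeaklySmoothAt E g x₀)
    (L : A →ₗ[ℝ] B →ₗ[ℝ] C) : WeaklySmoothAt E (fun x ↦ L (f x) (g x)) x₀ := by
  have expand : (fun x ↦ L (f x) (g x)) =
      fun x ↦ ∑ i, (finBasis ℝ A).coord i (f x) • L (finBasis ℝ A i) (g x) := by
    funext x
    conv_lhs => rw [← (finBasis ℝ A).sum_repr (f x)]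
    simp only [map_sum, map_smul, LinearMap.sum_apply, LinearMap.smul_apply, Basis.coord_apply]
  rw [expand]
  exact sum fun i _ ↦ smul (hf _) (hg.map _)

theorem contMDiffAt {F : Type*} [NormedAddCommGroup F] [NormedSpace ℝ F] [FiniteDimensional ℝ F]
    {f : S → F} (hf : WeaklySmoothAt E f x₀) : ContMDiffAt 𝓘(ℝ, E) 𝓘(ℝ, F) ∞ f x₀ := by
  have expand : f = fun x ↦ ∑ i, (finBasis ℝ F).coord i (f x) • finBasis ℝ F i :=
    funext fun x ↦ ((finBasis ℝ F).sum_repr (f x)).symm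
  rw [expand]
  exact ContMDiffAt.sum fun i _ ↦ (hf _).smul contMDiffAt_const

theorem of_apply_basis {ι : Type*} [Finite ι] (b : Basis ι ℝ A) {K : S → A →ₗ[ℝ] B}
    (h : ∀ i, WeaklySmoothAt E (fun x ↦ K x (b i)) x₀) : WeaklySmoothAt E K x₀ := by
  have := Fintype.ofFinite ι
  have expand : K = fun x ↦ ∑ i, LinearMap.smulRightₗ (b.coord i) (K x (b i)) := by
    refine funext fun x ↦ b.ext fun i ↦ ?_
    classical
    simp [LinearMap.sum_apply, Finsupp.single_apply]
  rw [expand]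
  exact sum fun i _ ↦ (h i).map _

/-- Near `x₀` one has `d x = (d x ∘ K x) ∘ (K x)⁻¹`, and inversion of linear maps is smooth. -/
theorem of_comp {A B : Type*} [NormedAddCommGroup A] [NormedSpace ℝ A] [FiniteDimensional ℝ A]
    [NormedAddCommGroup B] [NormedSpace ℝ B] [FiniteDimensional ℝ B] [FiniteDimensional ℝ C]
    {K : S → A →ₗ[ℝ] B} (hK : WeaklySmoothAt E K x₀) (hbij : Function.Bijective (K x₀))
    {d : S → B →ₗ[ℝ] C} (hd : WeaklySmoothAt E (fun x ↦ d x ∘ₗ K x) x₀) :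
    WeaklySmoothAt E d x₀ := by
  have : CompleteSpace A := FiniteDimensional.complete ℝ A
  let Φ := (LinearEquiv.ofBijective (K x₀) hbij).toContinuousLinearEquiv
  have hΦ : LinearMap.toContinuousLinearMap (K x₀) = Φ := rfl
  have hK' : ContMDiffAt 𝓘(ℝ, E) 𝓘(ℝ, A →L[ℝ] B) ∞
      (fun x ↦ LinearMap.toContinuousLinearMap (K x)) x₀ :=
    (hK.map LinearMap.toContinuousLinearMap.toLinearMap).contMDiffAt
  have hinv : WeaklySmoothAt E
      (fun x ↦ (LinearMap.toContinuousLinearMap (K x)).inverse) x₀ := by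
    refine weaklySmoothAt_of_contMDiffAt (ContMDiffAt.comp (g := ContinuousLinearMap.inverse)
      (I' := 𝓘(ℝ, A →L[ℝ] B)) x₀ ?_ hK')
    rw [hΦ]
    exact (contDiffAt_map_inverse Φ).contMDiffAt
  refine (hd.map₂ (hinv.map (ContinuousLinearMap.coeLM ℝ)) (LinearMap.llcomp ℝ B A C)).congr ?_
  have hev := hK'.continuousAt.eventually (hΦ ▸ Φ.nhds)
  filter_upwards [hev] with x ⟨Ψ, hΨ⟩
  ext w
  have key : (LinearMap.toContinuousLinearMap (K x)).inverse = Ψ.symm := by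
    rw [← hΨ, ContinuousLinearMap.inverse_equiv]
  have key' : K x (Ψ.symm w) = w := by
    rw [← LinearMap.coe_toContinuousLinearMap' (K x), ← hΨ]
    exact Ψ.apply_symm_apply w
  simp [key, key']

end WeaklySmoothAt

end WeakSmoothness

open MixedExterior

theorem eventually_mem_baseSet_trivializationAt {B : Type*} [TopologicalSpace B] (F : Type*)
    [TopologicalSpace F] (V : B → Type*) [TopologicalSpace (TotalSpace F V)]
    [∀ x, TopologicalSpace (V x)] [FiberBundle F V] (x₀ : B) :
    ∀ᶠ x in nhds x₀, x ∈ (trivializationAt F V x₀).baseSet :=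
  (trivializationAt F V x₀).open_baseSet.mem_nhds (FiberBundle.mem_baseSet_trivializationAt' x₀)

section TangentFrames

variable {E : Type*} [NormedAddCommGroup E] [NormedSpace ℝ E]
  {S : Type*} [TopologicalSpace S] [ChartedSpace E S] [IsManifold 𝓘(ℝ, E) ∞ S]

variable (E) in
/-- The preferred trivialization of the tangent bundle at `x₀`. -/
abbrev tanTriv (x₀ : S) : Trivialization E (π E (TangentSpace 𝓘(ℝ, E) : S → Type _)) :=
  trivializationAt E (TangentSpace 𝓘(ℝ, E) : S → Type _) x₀

variable (E) in
theorem mem_baseSet_tanTriv (x₀ : S) : x₀ ∈ (tanTriv E x₀).baseSet :=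
  FiberBundle.mem_baseSet_trivializationAt' x₀

variable (E) in
theorem eventually_mem_baseSet_tanTriv (x₀ : S) : ∀ᶠ x in nhds x₀, x ∈ (tanTriv E x₀).baseSet :=
  eventually_mem_baseSet_trivializationAt E _ x₀

variable [FiniteDimensional ℝ E]

/-- The basis of a tangent space near `x₀` given by the preferred trivialization at `x₀`. -/
def tanBasis {x₀ x : S} (hx : x ∈ (tanTriv E x₀).baseSet) :
    Basis (Fin (finrank ℝ E)) ℝ (TangentSpace 𝓘(ℝ, E) x) :=
  (tanTriv E x₀).basisAt (finBasis ℝ E) hx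

theorem coord_tanBasis {x₀ x : S} (hx : x ∈ (tanTriv E x₀).baseSet) (μ) :
    (tanBasis hx).coord μ = (finBasis ℝ E).coord μ ∘ₗ (tanTriv E x₀).linearMapAt ℝ x := by
  ext u
  simp only [LinearMap.comp_apply, Trivialization.linearMapAt_def_of_mem _ hx]
  rfl

theorem coord_tanBasis_comp_symmₗ {x₀ x : S} (hx : x ∈ (tanTriv E x₀).baseSet) (μ) :
    (tanBasis hx).coord μ ∘ₗ (tanTriv E x₀).symmₗ ℝ x = (finBasis ℝ E).coord μ := by
  ext u
  rw [coord_tanBasis, LinearMap.comp_apply, LinearMap.comp_apply,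
    Trivialization.linearMapAt_symmₗ _ hx]

/-- The local frame of the tangent bundle given by the preferred trivialization at `x₀`. -/
abbrev tanFrame (x₀ : S) (μ : Fin (finrank ℝ E)) (x : S) : TangentSpace 𝓘(ℝ, E) x :=
  (tanTriv E x₀).localFrame (finBasis ℝ E) μ x

theorem tanFrame_eq {x₀ x : S} (hx : x ∈ (tanTriv E x₀).baseSet) (μ) :
    tanFrame x₀ μ x = tanBasis hx μ :=
  Trivialization.localFrame_apply_of_mem_baseSet _ _ hx

theorem contMDiffOn_tanFrame (x₀ : S) (μ) :
    ContMDiffOn 𝓘(ℝ, E) (𝓘(ℝ, E).prod 𝓘(ℝ, E)) ∞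
      (fun x ↦ TotalSpace.mk' E x (tanFrame x₀ μ x : TangentSpace 𝓘(ℝ, E) x))
      (tanTriv E x₀).baseSet :=
  (tanTriv E x₀).contMDiffOn_localFrame_baseSet ∞ (finBasis ℝ E) μ

theorem contMDiffAt_tanFrame {x₀ x : S} (hx : x ∈ (tanTriv E x₀).baseSet) (μ) :
    ContMDiffAt 𝓘(ℝ, E) (𝓘(ℝ, E).prod 𝓘(ℝ, E)) ∞
      (fun x ↦ TotalSpace.mk' E x (tanFrame x₀ μ x : TangentSpace 𝓘(ℝ, E) x)) x :=
  contMDiffAt_localFrame_of_mem ∞ _ (finBasis ℝ E) μ hx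

end TangentFrames

section Sections

variable {E : Type*} [NormedAddCommGroup E] [NormedSpace ℝ E]
  {S : Type*} [TopologicalSpace S] [ChartedSpace E S]
  {F : Type*} [NormedAddCommGroup F] [NormedSpace ℝ F] [FiniteDimensional ℝ F]
  {V : S → Type*} [TopologicalSpace (TotalSpace F V)]
  [∀ x, AddCommGroup (V x)] [∀ x, Module ℝ (V x)] [∀ x, TopologicalSpace (V x)]
  [FiberBundle F V] [VectorBundle ℝ F V]

theorem weaklySmoothAt_section {s : (x : S) → V x} {x₀ : S}
    (hs : ContMDiffAt 𝓘(ℝ, E) (𝓘(ℝ, E).prod 𝓘(ℝ, F)) ∞ (fun x ↦ TotalSpace.mk' F x (s x)) x₀) :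
    WeaklySmoothAt E (fun x ↦ (trivializationAt F V x₀).linearMapAt ℝ x (s x)) x₀ := by
  rw [contMDiffAt_section] at hs
  refine (weaklySmoothAt_of_contMDiffAt hs).congr ?_
  filter_upwards [eventually_mem_baseSet_trivializationAt F V x₀] with x hx
  rw [Trivialization.coe_linearMapAt_of_mem _ hx]

/-- In the trivialization at `x₀`, the frame is an invertible matrix depending smoothly on `x`. -/
theorem weaklySmoothAt_functional_of_frame {x₀ : S} {ι : Type*} [Finite ι]
    {s : ι → (x : S) → V x}
    (hs : ∀ i, ContMDiffAt 𝓘(ℝ, E) (𝓘(ℝ, E).prod 𝓘(ℝ, F)) ∞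
      (fun x ↦ TotalSpace.mk' F x (s i x)) x₀)
    (b : Basis ι ℝ (V x₀)) (hb : ∀ i, b i = s i x₀) {d : (x : S) → Dual ℝ (V x)}
    (hd : ∀ i, ContMDiffAt 𝓘(ℝ, E) 𝓘(ℝ, ℝ) ∞ (fun x ↦ d x (s i x)) x₀) :
    WeaklySmoothAt E (fun x ↦ d x ∘ₗ (trivializationAt F V x₀).symmₗ ℝ x) x₀ := by
  classical
  have := Fintype.ofFinite ι
  let σ := trivializationAt F V x₀
  have hx₀ := FiberBundle.mem_baseSet_trivializationAt' (F := F) (E := V) x₀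
  let K (x : S) : (ι → ℝ) →ₗ[ℝ] F := Fintype.linearCombination ℝ fun i ↦ σ.linearMapAt ℝ x (s i x)
  have hK_apply (x i) : K x (Pi.basisFun ℝ ι i) = σ.linearMapAt ℝ x (s i x) := by
    simp [K]
  have hK : WeaklySmoothAt E K x₀ := .of_apply_basis (Pi.basisFun ℝ ι) fun i ↦ by
    simpa only [hK_apply] using weaklySmoothAt_section (hs i)
  have hK₀ : K x₀ = (b.equivFun.symm ≪≫ₗ σ.linearEquivAt ℝ x₀ hx₀ : (ι → ℝ) →ₗ[ℝ] F) :=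
    (Pi.basisFun ℝ ι).ext fun i ↦ by
      rw [hK_apply, Trivialization.linearMapAt_def_of_mem σ hx₀]
      simp [hb]
  refine .of_comp hK (hK₀ ▸ LinearEquiv.bijective _) (.of_apply_basis (Pi.basisFun ℝ ι) fun i ↦ ?_)
  refine (weaklySmoothAt_of_contMDiffAt (hd i)).congr ?_
  filter_upwards [eventually_mem_baseSet_trivializationAt F V x₀] with x hx
  rw [LinearMap.comp_apply, LinearMap.comp_apply, hK_apply, Trivialization.symmₗ_linearMapAt _ hx]

end Sections

section SmoothFields

variable {E : Type*} [NormedAddCommGroup E] [NormedSpace ℝ E]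
  {S : Type*} [TopologicalSpace S] [ChartedSpace E S] [IsManifold 𝓘(ℝ, E) ∞ S]
  {F : Type*} [NormedAddCommGroup F] [NormedSpace ℝ F]
  {V : S → Type*} [TopologicalSpace (TotalSpace F V)]
  [∀ x, AddCommGroup (V x)] [∀ x, Module ℝ (V x)] [∀ x, TopologicalSpace (V x)]
  [FiberBundle F V] [VectorBundle ℝ F V]

variable (E F V) in
/-- The algebra homomorphism which reads a form at `x` in the preferred trivializations at `x₀`. -/
def chartMap (x₀ x : S) : FormFibre E V x →ₐ[ℝ] MixedExterior ℝ E F :=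
  ExteriorAlgebra.map (coordMap E F V x₀ x)

theorem chartMap_ofDual (x₀ x : S) (ξ : Dual ℝ (TangentSpace 𝓘(ℝ, E) x)) :
    chartMap E F V x₀ x (ofDual ξ) = ofDual (ξ ∘ₗ (tanTriv E x₀).symmₗ ℝ x) := by
  refine (ExteriorAlgebra.map_apply_ι _ _).trans ?_
  simp only [coordMap, ofDual, LinearMap.comp_apply, LinearMap.prodMap_apply, LinearMap.inl_apply,
    map_zero]
  rfl

theorem chartMap_ofVec (x₀ x : S) (w : V x) :
    chartMap E F V x₀ x (ofVec w) = ofVec ((trivializationAt F V x₀).linearMapAt ℝ x w) := by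
  refine (ExteriorAlgebra.map_apply_ι _ _).trans ?_
  simp only [coordMap, ofVec, LinearMap.comp_apply, LinearMap.prodMap_apply, LinearMap.inr_apply,
    map_zero]

theorem chartMap_contract {x₀ x : S} (hx : x ∈ (trivializationAt F V x₀).baseSet)
    (d : Dual ℝ (V x)) (X : FormFibre E V x) :
    chartMap E F V x₀ x (contract d X) =
      contract (d ∘ₗ (trivializationAt F V x₀).symmₗ ℝ x) (chartMap E F V x₀ x X) := by
  have pullback : d ∘ₗ LinearMap.snd ℝ _ _ =
      ((d ∘ₗ (trivializationAt F V x₀).symmₗ ℝ x) ∘ₗ LinearMap.snd ℝ _ _) ∘ₗ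
        coordMap E F V x₀ x :=
    LinearMap.ext fun p ↦ (congrArg d (Trivialization.symmₗ_linearMapAt _ hx p.2)).symm
  change chartMap E F V x₀ x (CliffordAlgebra.contractLeft (d ∘ₗ LinearMap.snd ℝ _ _) X) = _
  rw [pullback]
  exact map_contractLeft _ _ X

theorem chartMap_interior_symmₗ (x₀ x : S) (w : E) (X : FormFibre E V x) :
    chartMap E F V x₀ x (interior ((tanTriv E x₀).symmₗ ℝ x w) X) =
      interior w (chartMap E F V x₀ x X) :=
  map_contractLeft (coordMap E F V x₀ x) (Dual.eval ℝ E w ∘ₗ LinearMap.fst ℝ _ _) X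

theorem isSmoothField_iff {α : FormField E V} : IsSmoothField E F V α ↔
    ∀ x₀, WeaklySmoothAt E (fun x ↦ chartMap E F V x₀ x (α x)) x₀ := Iff.rfl

section

variable [FiniteDimensional ℝ F]

theorem weaklySmoothAt_chartMap_contract {x₀ : S} {α : FormField E V}
    (hα : WeaklySmoothAt E (fun x ↦ chartMap E F V x₀ x (α x)) x₀) {d : (x : S) → Dual ℝ (V x)}
    (hd : WeaklySmoothAt E (fun x ↦ d x ∘ₗ (trivializationAt F V x₀).symmₗ ℝ x) x₀) :
    WeaklySmoothAt E (fun x ↦ chartMap E F V x₀ x (contract (d x) (α x))) x₀ := by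
  refine (hd.map₂ hα contract).congr ?_
  filter_upwards [eventually_mem_baseSet_trivializationAt F V x₀] with x hx
  exact chartMap_contract hx _ _

theorem IsSmoothField.contract {α : FormField E V} (hα : IsSmoothField E F V α)
    {d : (x : S) → Dual ℝ (V x)}
    (hd : ∀ x₀, WeaklySmoothAt E (fun x ↦ d x ∘ₗ (trivializationAt F V x₀).symmₗ ℝ x) x₀) :
    IsSmoothField E F V fun x ↦ contract (d x) (α x) :=
  isSmoothField_iff.mpr fun x₀ ↦
    weaklySmoothAt_chartMap_contract (isSmoothField_iff.mp hα x₀) (hd x₀)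

end

variable [FiniteDimensional ℝ E]

theorem chartMap_ofDual_coord_tanBasis {x₀ x : S} (hx : x ∈ (tanTriv E x₀).baseSet) (μ) :
    chartMap E F V x₀ x (ofDual ((tanBasis hx).coord μ)) = ofDual ((finBasis ℝ E).coord μ) := by
  rw [chartMap_ofDual, coord_tanBasis_comp_symmₗ]

theorem chartMap_interior_tanBasis {x₀ x : S} (hx : x ∈ (tanTriv E x₀).baseSet) (μ)
    (X : FormFibre E V x) :
    chartMap E F V x₀ x (interior (tanBasis hx μ) X) =
      interior (finBasis ℝ E μ) (chartMap E F V x₀ x X) := by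
  rw [← chartMap_interior_symmₗ, Trivialization.symmₗ_apply _ hx, tanBasis,
    Trivialization.basisAt, Basis.map_apply]
  rfl

theorem weaklySmoothAt_chartMap_interior {x₀ : S} {α : FormField E V}
    (hα : WeaklySmoothAt E (fun x ↦ chartMap E F V x₀ x (α x)) x₀) (μ) :
    WeaklySmoothAt E (fun x ↦ chartMap E F V x₀ x (interior (tanFrame x₀ μ x) (α x))) x₀ := by
  refine (hα.map (interior (finBasis ℝ E μ))).congr ?_
  filter_upwards [eventually_mem_baseSet_tanTriv E x₀] with x hx
  rw [tanFrame_eq hx, chartMap_interior_tanBasis]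

variable [FiniteDimensional ℝ F]

theorem IsSmoothField.mul {α β : FormField E V} (hα : IsSmoothField E F V α)
    (hβ : IsSmoothField E F V β) : IsSmoothField E F V (α * β) :=
  isSmoothField_iff.mpr fun x₀ ↦ by
    simp only [Pi.mul_apply, map_mul]
    exact (isSmoothField_iff.mp hα x₀).map₂ (isSmoothField_iff.mp hβ x₀) (LinearMap.mul ℝ _)

theorem mul_mem_Omega {i j k l : ℕ} {α β : FormField E V} (hα : α ∈ Omega E F V i j)
    (hβ : β ∈ Omega E F V k l) : α * β ∈ Omega E F V (i + k) (j + l) :=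
  ⟨fun x ↦ mul_mem_bideg (hα.1 x) (hβ.1 x), hα.2.mul hβ.2⟩

end SmoothFields

section Coframe

variable {E : Type*} [NormedAddCommGroup E] [NormedSpace ℝ E]
  {S : Type*} [TopologicalSpace S] [ChartedSpace E S] [IsManifold 𝓘(ℝ, E) ∞ S]
  {F : Type*} [NormedAddCommGroup F] [NormedSpace ℝ F]
  {V : S → Type*} [TopologicalSpace (TotalSpace F V)]
  [∀ x, AddCommGroup (V x)] [∀ x, Module ℝ (V x)] [∀ x, TopologicalSpace (V x)]
  [∀ x, IsTopologicalAddGroup (V x)] [∀ x, ContinuousSMul ℝ (V x)]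
  [FiberBundle F V] [VectorBundle ℝ F V]

/-- The coframe at `x` as a linear map, without its continuity. -/
abbrev coframeAt (e : BoundaryCoframe E F V) (x : S) : TangentSpace 𝓘(ℝ, E) x →ₗ[ℝ] V x :=
  (e.toFun x : TangentSpace 𝓘(ℝ, E) x →ₗ[ℝ] V x)

theorem contMDiffAt_coframe_apply (e : BoundaryCoframe E F V) {x : S}
    {s : (x : S) → TangentSpace 𝓘(ℝ, E) x}
    (hs : ContMDiffAt 𝓘(ℝ, E) (𝓘(ℝ, E).prod 𝓘(ℝ, E)) ∞ (fun x ↦ TotalSpace.mk' E x (s x)) x) :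
    ContMDiffAt 𝓘(ℝ, E) (𝓘(ℝ, E).prod 𝓘(ℝ, F)) ∞
      (fun x ↦ TotalSpace.mk' F x (e.toFun x (s x))) x :=
  (e.contMDiff x).clm_bundle_apply hs

theorem transversalForm_mem_Omega [FiniteDimensional ℝ F] {e : BoundaryCoframe E F V}
    (en : TransversalSection E F V e) :
    transversalForm en ∈ Omega E F V 0 1 :=
  ⟨fun _ ↦ ofVec_mem_bideg _, isSmoothField_iff.mpr fun x₀ ↦
    ((weaklySmoothAt_section (en.contMDiff x₀)).map ofVec).congr
      (Filter.Eventually.of_forall fun _ ↦ chartMap_ofVec _ _ _)⟩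

variable [FiniteDimensional ℝ E]

theorem coframeForm_eq (e : BoundaryCoframe E F V) {κ : Type*} [Fintype κ] {x : S}
    (b : Basis κ ℝ (TangentSpace 𝓘(ℝ, E) x)) : coframeForm e x = coframe b (coframeAt e x) :=
  coframe_basis_change _ _ _

variable [FiniteDimensional ℝ F]

theorem coframeForm_mem_Omega (e : BoundaryCoframe E F V) :
    coframeForm e ∈ Omega E F V 1 1 := by
  refine ⟨fun x ↦ coframe_mem_bideg _ (coframeAt e x), isSmoothField_iff.mpr fun x₀ ↦ ?_⟩
  have hsmooth (μ) : WeaklySmoothAt E (fun x ↦ ofDual ((finBasis ℝ E).coord μ) *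
      (ofVec ((trivializationAt F V x₀).linearMapAt ℝ x (e.toFun x (tanFrame x₀ μ x))) :
        MixedExterior ℝ E F)) x₀ :=
    (weaklySmoothAt_section (contMDiffAt_coframe_apply e
      (contMDiffAt_tanFrame (mem_baseSet_tanTriv E x₀) μ))).map
        (LinearMap.mulLeft ℝ (ofDual ((finBasis ℝ E).coord μ)) ∘ₗ ofVec)
  refine (WeaklySmoothAt.sum (s := Finset.univ) fun μ _ ↦ hsmooth μ).congr ?_
  filter_upwards [eventually_mem_baseSet_tanTriv E x₀] with x hx
  rw [coframeForm_eq e (tanBasis hx), coframe, map_sum]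
  refine Finset.sum_congr rfl fun μ _ ↦ ?_
  rw [map_mul, chartMap_ofDual_coord_tanBasis, chartMap_ofVec, tanFrame_eq hx,
    ContinuousLinearMap.coe_coe]

end Coframe

theorem MixedExterior.trace_basis_change {R T W κ ι : Type*} [CommRing R] [AddCommGroup T]
    [Module R T] [AddCommGroup W] [Module R W] [Fintype κ] [Fintype ι] (b : Basis κ R T)
    (b' : Basis ι R T) (r : W →ₗ[R] T) (X : MixedExterior R T W) :
    trace b r X = trace b' r X := by
  simp only [trace_apply]
  exact sum_coord_basis_change b b' ((contract ∘ₗ LinearMap.lcomp R R r).compl₂ (interior.flip X))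

section SplittingFields

variable {E : Type*} [NormedAddCommGroup E] [NormedSpace ℝ E] [FiniteDimensional ℝ E]
  {S : Type*} [TopologicalSpace S] [ChartedSpace E S] [IsManifold 𝓘(ℝ, E) ∞ S]
  {F : Type*} [NormedAddCommGroup F] [NormedSpace ℝ F] [FiniteDimensional ℝ F]
  {V : S → Type*} [TopologicalSpace (TotalSpace F V)]
  [∀ x, AddCommGroup (V x)] [∀ x, Module ℝ (V x)] [∀ x, TopologicalSpace (V x)]
  [∀ x, IsTopologicalAddGroup (V x)] [∀ x, ContinuousSMul ℝ (V x)]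
  [FiberBundle F V] [VectorBundle ℝ F V]
  {e : BoundaryCoframe E F V} {en : TransversalSection E F V e}

theorem weaklySmoothAt_functional_of_splitting {x₀ : S}
    (s : Splitting (coframeAt e x₀) (en.toFun x₀)) {d : (x : S) → Dual ℝ (V x)}
    (hframe : ∀ μ, ContMDiffAt 𝓘(ℝ, E) 𝓘(ℝ, ℝ) ∞ (fun x ↦ d x (e.toFun x (tanFrame x₀ μ x))) x₀)
    (hn : ContMDiffAt 𝓘(ℝ, E) 𝓘(ℝ, ℝ) ∞ (fun x ↦ d x (en.toFun x)) x₀) :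
    WeaklySmoothAt E (fun x ↦ d x ∘ₗ (trivializationAt F V x₀).symmₗ ℝ x) x₀ := by
  have hx₀ := mem_baseSet_tanTriv E x₀
  refine weaklySmoothAt_functional_of_frame
    (s := Sum.elim (fun μ x ↦ e.toFun x (tanFrame x₀ μ x)) fun _ ↦ en.toFun)
    (Sum.rec (fun μ ↦ contMDiffAt_coframe_apply e (contMDiffAt_tanFrame hx₀ μ))
      fun _ ↦ en.contMDiff x₀)
    (s.basis (tanBasis hx₀)) (Sum.rec (fun μ ↦ ?_) (s.basis_inr _))
    (Sum.rec hframe fun _ ↦ hn)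
  rw [Splitting.basis_inl, Sum.elim_inl, tanFrame_eq hx₀, ContinuousLinearMap.coe_coe]

variable (s : ∀ x, Splitting (coframeAt e x) (en.toFun x))

theorem weaklySmoothAt_coord (x₀ : S) :
    WeaklySmoothAt E (fun x ↦ (s x).coord ∘ₗ (trivializationAt F V x₀).symmₗ ℝ x) x₀ := by
  refine weaklySmoothAt_functional_of_splitting (s x₀) (fun μ ↦ ?_) ?_
  · have h (x) : (s x).coord (e.toFun x (tanFrame x₀ μ x)) = 0 :=
      LinearMap.congr_fun (s x).coord_comp _
    simpa only [h] using contMDiffAt_const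
  · simpa only [Splitting.coord_self] using contMDiffAt_const

theorem weaklySmoothAt_coord_comp_proj (x₀ : S) (μ) :
    WeaklySmoothAt E (fun x ↦ ((finBasis ℝ E).coord μ ∘ₗ (tanTriv E x₀).linearMapAt ℝ x ∘ₗ
      (s x).proj) ∘ₗ (trivializationAt F V x₀).symmₗ ℝ x) x₀ := by
  refine weaklySmoothAt_functional_of_splitting (s x₀) (fun ν ↦ ?_) ?_
  · refine ContMDiffAt.congr_of_eventuallyEq
      (contMDiffAt_const (c := (finBasis ℝ E).coord μ (finBasis ℝ E ν))) ?_
    filter_upwards [eventually_mem_baseSet_tanTriv E x₀] with x hx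
    have hproj : (s x).proj (e.toFun x (tanFrame x₀ ν x)) = tanBasis hx ν :=
      (LinearMap.congr_fun (s x).proj_comp _).trans (tanFrame_eq hx ν)
    have hcoord := LinearMap.congr_fun (coord_tanBasis hx μ) (tanBasis hx ν)
    rw [LinearMap.comp_apply, LinearMap.comp_apply, hproj, ← LinearMap.comp_apply, ← hcoord,
      Basis.coord_apply, Basis.coord_apply, Basis.repr_self, Basis.repr_self]
  · simpa only [LinearMap.comp_apply, Splitting.proj_self, map_zero] using contMDiffAt_const

theorem contract_coord_mem_Omega {i j : ℕ} {Y : FormField E V} (hY : Y ∈ Omega E F V i (j + 1)) :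
    (fun x ↦ contract (s x).coord (Y x)) ∈ Omega E F V i j :=
  ⟨fun x ↦ contract_mem_bideg _ (hY.1 x), hY.2.contract (weaklySmoothAt_coord s)⟩

theorem trace_proj_mem_Omega {i j : ℕ} {Y : FormField E V}
    (hY : Y ∈ Omega E F V (i + 1) (j + 1)) :
    (fun x ↦ trace (tangentBasis x) (s x).proj (Y x)) ∈ Omega E F V i j := by
  refine ⟨fun x ↦ trace_mem_bideg _ _ (hY.1 x), isSmoothField_iff.mpr fun x₀ ↦ ?_⟩
  refine (WeaklySmoothAt.sum (s := Finset.univ) fun μ _ ↦ weaklySmoothAt_chartMap_contract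
    (weaklySmoothAt_chartMap_interior (isSmoothField_iff.mp hY.2 x₀) μ)
    (weaklySmoothAt_coord_comp_proj s x₀ μ)).congr ?_
  filter_upwards [eventually_mem_baseSet_tanTriv E x₀] with x hx
  rw [trace_basis_change _ (tanBasis hx), trace_apply, map_sum]
  simp only [tanFrame_eq hx, coord_tanBasis, LinearMap.comp_assoc]

theorem dualPart_mem_Omega {Y : FormField E V} (hY : Y ∈ Omega E F V 2 1) :
    (fun x ↦ (s x).dualPart (tangentBasis x) (Y x)) ∈ Omega E F V 1 0 :=
  Submodule.smul_mem _ _ <| trace_proj_mem_Omega s <| Submodule.sub_mem _ hY <|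
    mul_mem_Omega (k := 0) (l := 1) (contract_coord_mem_Omega s hY) (transversalForm_mem_Omega en)

end SplittingFields

theorem MixedExterior.commute_of_mem_bideg_two_zero {R T W : Type*} [CommRing R] [AddCommGroup T]
    [Module R T] [AddCommGroup W] [Module R W] {B : MixedExterior R T W} (hB : B ∈ bideg R T W 2 0)
    (X : MixedExterior R T W) : Commute B X := by
  rw [bideg, pow_zero, mul_one, pow_two] at hB
  induction hB using Submodule.mul_induction_on' with
  | add B _ B' _ hB hB' => exact hB.add_left hB'
  | mem_mul_mem A hA A' hA' =>
    obtain ⟨ξ, rfl⟩ := hA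
    obtain ⟨ξ', rfl⟩ := hA'
    exact commute_ι_mul_ι _ _ X

section LefschetzComplement

variable {E : Type*} [NormedAddCommGroup E] [NormedSpace ℝ E] [FiniteDimensional ℝ E]
  {S : Type*} [TopologicalSpace S] [ChartedSpace E S] [IsManifold 𝓘(ℝ, E) ∞ S]
  {F : Type*} [NormedAddCommGroup F] [NormedSpace ℝ F]
  {V : S → Type*} [TopologicalSpace (TotalSpace F V)]
  [∀ x, AddCommGroup (V x)] [∀ x, Module ℝ (V x)] [∀ x, TopologicalSpace (V x)]
  [∀ x, IsTopologicalAddGroup (V x)] [∀ x, ContinuousSMul ℝ (V x)]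
  [FiberBundle F V] [VectorBundle ℝ F V]
  {e : BoundaryCoframe E F V} {en : TransversalSection E F V e}

theorem commute_coframeForm (e : BoundaryCoframe E F V) (X : FormField E V) :
    Commute (coframeForm e) X :=
  funext fun x ↦ commute_coframe (tangentBasis x) (coframeAt e x) (X x)

theorem mem_kerW_iff {k i j : ℕ} {X : FormField E V} :
    X ∈ kerW e k i j ↔ X ∈ Omega E F V i j ∧ coframeForm e ^ k * X = 0 := by
  rw [((commute_coframeForm e X).pow_left k).eq]
  rfl

/-- The splitting `V = e(TS) ⊕ ℝ e_n` of a bundle of rank `dim S + 1`. -/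
def splitting [FiniteDimensional ℝ F] (en : TransversalSection E F V e)
    (hd : finrank ℝ E + 1 = finrank ℝ F) (x : S) : Splitting (coframeAt e x) (en.toFun x) :=
  let Φ : V x ≃ₗ[ℝ] F := (trivializationAt F V x).linearEquivAt ℝ x
    (FiberBundle.mem_baseSet_trivializationAt' x)
  have : FiniteDimensional ℝ (TangentSpace 𝓘(ℝ, E) x) := inferInstanceAs (FiniteDimensional ℝ E)
  have : FiniteDimensional ℝ (V x) := Φ.symm.finiteDimensional
  .ofInjective (e.injective x) (en.transversal x) (hd.trans Φ.finrank_eq.symm)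

variable (en) in
/-- The complement `e Ω^{1,0} + Ω^{2,0} e_n` of the kernel of `W_{N-3}` in `Ω^{2,1}`. -/
def lefschetzComplement : Submodule ℝ (FormField E V) :=
  (Omega E F V 1 0).map (LinearMap.mulLeft ℝ (coframeForm e)) ⊔
    (Omega E F V 2 0).map (LinearMap.mulRight ℝ (transversalForm en))

theorem mem_lefschetzComplement_iff {X : FormField E V} :
    X ∈ lefschetzComplement en ↔ ∃ ξ ∈ Omega E F V 1 0, ∃ B ∈ Omega E F V 2 0,
      coframeForm e * ξ + B * transversalForm en = X := by
  simp only [lefschetzComplement, Submodule.mem_sup, Submodule.mem_map,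
    LinearMap.mulLeft_apply, LinearMap.mulRight_apply, exists_exists_and_eq_and]

theorem mem_kerW_iff_isPrimitive (s : ∀ x, Splitting (coframeAt e x) (en.toFun x)) {k : ℕ}
    (hk : k + 2 = finrank ℝ E) {Y : FormField E V} :
    Y ∈ kerW e k 2 1 ↔
      Y ∈ Omega E F V 2 1 ∧ ∀ x, (s x).IsPrimitive (tangentBasis x) (Y x) := by
  refine mem_kerW_iff.trans <| and_congr_right fun hY ↦ ?_
  exact funext_iff.trans <| forall_congr' fun x ↦
    coframe_pow_mul_eq_zero_iff_isPrimitive (by rw [hk, Fintype.card_fin]) (hY.1 x)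

theorem disjoint_kerW_lefschetzComplement (s : ∀ x, Splitting (coframeAt e x) (en.toFun x)) {k : ℕ}
    (hk : k + 2 = finrank ℝ E) : Disjoint (kerW e k 2 1) (lefschetzComplement en) := by
  rw [Submodule.disjoint_def]
  intro Y hY hY'
  obtain ⟨ξ, hξ, B, hB, rfl⟩ := mem_lefschetzComplement_iff.mp hY'
  exact funext fun x ↦ (((mem_kerW_iff_isPrimitive s hk).mp hY).2 x
    ).coframe_mul_add_mul_ofVec_eq_zero (by rw [Fintype.card_fin]; omega) (hξ.1 x) (hB.1 x)

theorem transversalForm_mul_mem_imW {k : ℕ} [FiniteDimensional ℝ F] {X : FormField E V}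
    (hX : X ∈ lefschetzComplement en) :
    transversalForm en * coframeForm e ^ k * X ∈ imW e (k + 1) 1 1 := by
  obtain ⟨ξ, hξ, B, hB, rfl⟩ := mem_lefschetzComplement_iff.mp hX
  refine ⟨transversalForm en * ξ,
    mul_mem_Omega (i := 0) (j := 1) (k := 1) (l := 0) (transversalForm_mem_Omega en) hξ, ?_⟩
  have hn : transversalForm en * transversalForm en = 0 :=
    funext fun x ↦ ExteriorAlgebra.ι_sq_zero _
  have hBn : B * transversalForm en = transversalForm en * B :=
    funext fun x ↦ commute_of_mem_bideg_two_zero (hB.1 x) _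
  have hen := ((commute_coframeForm e (transversalForm en)).pow_left k).eq
  calc transversalForm en * ξ * coframeForm e ^ (k + 1)
      = transversalForm en * coframeForm e ^ k * (coframeForm e * ξ) := by
        rw [mul_assoc, ← ((commute_coframeForm e ξ).pow_left (k + 1)).eq, pow_succ]
        simp only [mul_assoc]
    _ = _ := by
        rw [mul_add, hBn, ← hen, mul_assoc _ _ (transversalForm en * B), ← mul_assoc _ _ B, hn,
          zero_mul, mul_zero, add_zero]

variable [FiniteDimensional ℝ F]

theorem lefschetzComplement_le : lefschetzComplement en ≤ Omega E F V 2 1 := by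
  intro X hX
  obtain ⟨ξ, hξ, B, hB, rfl⟩ := mem_lefschetzComplement_iff.mp hX
  exact Submodule.add_mem _
    (mul_mem_Omega (i := 1) (j := 1) (k := 1) (l := 0) (coframeForm_mem_Omega e) hξ)
    (mul_mem_Omega (i := 2) (j := 0) (k := 0) (l := 1) hB (transversalForm_mem_Omega en))

theorem kerW_sup_lefschetzComplement (s : ∀ x, Splitting (coframeAt e x) (en.toFun x)) {k : ℕ}
    (hk : k + 2 = finrank ℝ E) : kerW e k 2 1 ⊔ lefschetzComplement en = Omega E F V 2 1 := by
  refine le_antisymm (sup_le inf_le_left lefschetzComplement_le) fun Y hY ↦ ?_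
  have hC : coframeForm e * (fun x ↦ (s x).dualPart (tangentBasis x) (Y x)) +
      (fun x ↦ contract (s x).coord (Y x)) * transversalForm en ∈ lefschetzComplement en :=
    mem_lefschetzComplement_iff.mpr
      ⟨_, dualPart_mem_Omega s hY, _, contract_coord_mem_Omega s hY, rfl⟩
  rw [← sub_add_cancel Y (_ + _)]
  refine Submodule.add_mem_sup ((mem_kerW_iff_isPrimitive s hk).mpr
    ⟨Submodule.sub_mem _ hY (lefschetzComplement_le hC), fun x ↦ ?_⟩) hC
  exact (s x).isPrimitive_sub (by rw [Fintype.card_fin]; omega) (hY.1 x)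

theorem transversalForm_mul_mem_imW_iff (s : ∀ x, Splitting (coframeAt e x) (en.toFun x)) {k : ℕ}
    (hk : k + 3 = finrank ℝ E) {X : FormField E V} (hX : X ∈ Omega E F V 2 1) :
    transversalForm en * coframeForm e ^ k * X ∈ imW e (k + 1) 1 1 ↔
      X ∈ lefschetzComplement en := by
  refine ⟨fun hmem ↦ ?_, transversalForm_mul_mem_imW⟩
  obtain ⟨Y, hY, Z, hZ, rfl⟩ :=
    Submodule.mem_sup.mp ((kerW_sup_lefschetzComplement s (k := k + 1) hk).ge hX)
  rw [mul_add, Submodule.add_mem_iff_left _ (transversalForm_mul_mem_imW hZ)] at hmem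
  obtain ⟨U, hU, hUY⟩ := hmem
  have hY₀ : Y = 0 := funext fun x ↦ by
    obtain ⟨hY, hprim⟩ := (mem_kerW_iff_isPrimitive s (k := k + 1) hk).mp hY
    refine (hprim x).eq_zero_of_ofVec_mul_eq (by rw [hk, Fintype.card_fin]) (hU.1 x) (hY.1 x) ?_
    refine (mul_assoc _ _ _).symm.trans ((congrFun hUY x).symm.trans ?_)
    exact ((commute_coframe _ _ _).pow_left _).eq.symm
  rwa [hY₀, zero_add]

end LefschetzComplement

section Rho

variable {E : Type*} [NormedAddCommGroup E] [NormedSpace ℝ E]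
  {S : Type*} [TopologicalSpace S] [ChartedSpace E S]
  {F : Type*} [NormedAddCommGroup F] [NormedSpace ℝ F]
  {V : S → Type*} [∀ x, AddCommGroup (V x)] [∀ x, Module ℝ (V x)]

theorem contractInternal_eq {x : S} {i j : ℕ} {X : FormFibre E V x} (hX : X ∈ bidegree E V i j x)
    (d : Dual ℝ (V x)) : contractInternal d X = (-1 : ℝ) ^ (i + j + 1) • contract d X :=
  contractRight_eq_contractLeft (bideg_le_exteriorPower i j hX) _

variable [TopologicalSpace (TotalSpace F V)] [∀ x, TopologicalSpace (V x)]
  [FiberBundle F V] [VectorBundle ℝ F V]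

theorem contMDiffAt_inner (η : LorentzMetric E F V) {s t : (x : S) → V x} {x : S}
    (hs : ContMDiffAt 𝓘(ℝ, E) (𝓘(ℝ, E).prod 𝓘(ℝ, F)) ∞ (fun x ↦ TotalSpace.mk' F x (s x)) x)
    (ht : ContMDiffAt 𝓘(ℝ, E) (𝓘(ℝ, E).prod 𝓘(ℝ, F)) ∞ (fun x ↦ TotalSpace.mk' F x (t x)) x) :
    ContMDiffAt 𝓘(ℝ, E) 𝓘(ℝ, ℝ) ∞ (fun x ↦ η.inner x (s x) (t x)) x := by
  have h : ContMDiffAt 𝓘(ℝ, E) (𝓘(ℝ, E).prod 𝓘(ℝ, ℝ)) ∞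
      (fun y ↦ TotalSpace.mk' ℝ (E := Bundle.Trivial S ℝ) y (η.inner y (s y) (t y))) x :=
    ContMDiffAt.clm_bundle_apply₂ (F₁ := F) (F₂ := F) (η.contMDiff x) hs ht
  exact (contMDiffAt_totalSpace.mp h).2

/-- The map `V_x → V_x^*` given by the fibre metric. -/
def flatMap (η : LorentzMetric E F V) (x : S) : V x →ₗ[ℝ] Dual ℝ (V x) :=
  ContinuousLinearMap.coeLM ℝ ∘ₗ (η.inner x : V x →ₗ[ℝ] V x →L[ℝ] ℝ)

theorem act_eq (η : LorentzMetric E F V) {x : S} {A : FormFibre E V x}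
    (hA : A ∈ bidegree E V 1 2 x) (u : TangentSpace 𝓘(ℝ, E) x) (w : V x) :
    act η A u w = vecComponent (interior u (contract (flatMap η x w) A)) := by
  have h : contractInternal (flat η w) (insertVec u A) =
      interior u (contract (flatMap η x w) A) := by
    refine (contractInternal_eq (i := 0) (j := 2) (interior_mem_bideg u hA) _).trans ?_
    rw [contract_interior]
    norm_num
    rfl
  rw [act, h]
  rfl

theorem weaklySmoothAt_flatMap [FiniteDimensional ℝ F] [ContMDiffVectorBundle ∞ F V 𝓘(ℝ, E)]
    (η : LorentzMetric E F V) {s : (x : S) → V x} {x₀ : S}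
    (hs : ContMDiffAt 𝓘(ℝ, E) (𝓘(ℝ, E).prod 𝓘(ℝ, F)) ∞ (fun x ↦ TotalSpace.mk' F x (s x)) x₀) :
    WeaklySmoothAt E
      (fun x ↦ flatMap η x (s x) ∘ₗ (trivializationAt F V x₀).symmₗ ℝ x) x₀ := by
  have hx₀ := FiberBundle.mem_baseSet_trivializationAt' (F := F) (E := V) x₀
  have hframe (i) : ContMDiffAt 𝓘(ℝ, E) (𝓘(ℝ, E).prod 𝓘(ℝ, F)) ∞ (fun x ↦ TotalSpace.mk' F x
      ((trivializationAt F V x₀).localFrame (finBasis ℝ F) i x)) x₀ :=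
    contMDiffAt_localFrame_of_mem ∞ _ _ i hx₀
  exact weaklySmoothAt_functional_of_frame hframe
    ((trivializationAt F V x₀).basisAt (finBasis ℝ F) hx₀)
    (fun i ↦ (Trivialization.localFrame_apply_of_mem_baseSet _ _ hx₀).symm)
    fun i ↦ contMDiffAt_inner η hs (hframe i)

variable [∀ x, IsTopologicalAddGroup (V x)] [∀ x, ContinuousSMul ℝ (V x)]
  [IsManifold 𝓘(ℝ, E) ∞ S] [FiniteDimensional ℝ E]

theorem rho_apply (η : LorentzMetric E F V) (e : BoundaryCoframe E F V) {X : FormField E V} {x : S}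
    (hX : X x ∈ bidegree E V 1 2 x) :
    rho η e X x = bracket (tangentBasis x) (coframeAt e x) (flatMap η x) (X x) := by
  refine congrArg Neg.neg (Finset.sum_congr rfl fun ν _ ↦ ?_)
  rw [contractInternal_eq hX]
  norm_num
  rfl

theorem rho_mem_Omega [FiniteDimensional ℝ F] [ContMDiffVectorBundle ∞ F V 𝓘(ℝ, E)]
    (η : LorentzMetric E F V) (e : BoundaryCoframe E F V) {X : FormField E V}
    (hX : X ∈ Omega E F V 1 2) : rho η e X ∈ Omega E F V 2 1 := by
  refine ⟨fun x ↦ ?_, isSmoothField_iff.mpr fun x₀ ↦ ?_⟩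
  · rw [rho_apply η e (hX.1 x)]
    exact bracket_mem_bideg _ _ _ (hX.1 x)
  have hflat (μ) := weaklySmoothAt_flatMap η (contMDiffAt_coframe_apply e
    (contMDiffAt_tanFrame (mem_baseSet_tanTriv E x₀) μ))
  have hterm (μ) := (weaklySmoothAt_chartMap_contract (isSmoothField_iff.mp hX.2 x₀) (hflat μ)).map
    (LinearMap.mulLeft ℝ (ofDual ((finBasis ℝ E).coord μ)))
  refine ((WeaklySmoothAt.sum (s := Finset.univ) fun μ _ ↦ hterm μ).map (-LinearMap.id)).congr ?_
  filter_upwards [eventually_mem_baseSet_tanTriv E x₀] with x hx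
  rw [rho_apply η e (hX.1 x), bracket_basis_change _ _ _ (tanBasis hx), bracket, map_neg, map_sum]
  refine congrArg Neg.neg (Finset.sum_congr rfl fun μ _ ↦ ?_)
  rw [map_mul, chartMap_ofDual_coord_tanBasis, LinearMap.mulLeft_apply, tanFrame_eq hx]
  rfl

theorem rho_mem_kerW [FiniteDimensional ℝ F] [ContMDiffVectorBundle ∞ F V 𝓘(ℝ, E)]
    (η : LorentzMetric E F V) (e : BoundaryCoframe E F V) {k : ℕ} {X : FormField E V}
    (hX : X ∈ kerW e k 1 2) : rho η e X ∈ kerW e k 2 1 := by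
  refine mem_kerW_iff.mpr ⟨rho_mem_Omega η e hX.1, funext fun x ↦ ?_⟩
  rw [Pi.mul_apply, rho_apply η e (hX.1.1 x)]
  exact coframe_pow_mul_bracket_eq_zero _ _ _ (η.symm x)
    (congrFun (mem_kerW_iff.mp hX).2 x)

end Rho

section Torsion

variable {E : Type*} [NormedAddCommGroup E] [NormedSpace ℝ E]
  {S : Type*} [TopologicalSpace S] [ChartedSpace E S] [IsManifold 𝓘(ℝ, E) ∞ S]
  {F : Type*} [NormedAddCommGroup F] [NormedSpace ℝ F]
  {V : S → Type*} [TopologicalSpace (TotalSpace F V)]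
  [∀ x, AddCommGroup (V x)] [∀ x, Module ℝ (V x)] [∀ x, TopologicalSpace (V x)]
  [∀ x, IsTopologicalAddGroup (V x)] [∀ x, ContinuousSMul ℝ (V x)]
  [FiberBundle F V] [VectorBundle ℝ F V]

/-- Smoothness of a connection is a condition on global sections, so a local section is first
multiplied by a bump function. -/
theorem contMDiffAt_covariantDerivative_apply [FiniteDimensional ℝ E] [T2Space S]
    (ω₀ : CovariantDerivative 𝓘(ℝ, E) F V)
    [CovariantDerivative.ContMDiffCovariantDerivative ω₀ ∞] {U : Set S} (hU : IsOpen U) {x₀ : S}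
    (hx₀ : x₀ ∈ U) {σ : (x : S) → V x} (hσ : ContMDiffOn 𝓘(ℝ, E) (𝓘(ℝ, E).prod 𝓘(ℝ, F)) ∞
      (fun x ↦ TotalSpace.mk' F x (σ x)) U) {X : (x : S) → TangentSpace 𝓘(ℝ, E) x}
    (hX : ContMDiffAt 𝓘(ℝ, E) (𝓘(ℝ, E).prod 𝓘(ℝ, E)) ∞ (fun x ↦ TotalSpace.mk' E x (X x)) x₀) :
    ContMDiffAt 𝓘(ℝ, E) (𝓘(ℝ, E).prod 𝓘(ℝ, F)) ∞
      (fun x ↦ TotalSpace.mk' F x (ω₀ σ x (X x))) x₀ := by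
  obtain ⟨ψ, -, hψ⟩ := (SmoothBumpFunction.nhds_basis_tsupport (I := 𝓘(ℝ, E)) x₀).mem_iff.mp
    (hU.mem_nhds hx₀)
  have smooth_cutoff : ContMDiff 𝓘(ℝ, E) (𝓘(ℝ, E).prod 𝓘(ℝ, F)) ∞
      (fun x ↦ TotalSpace.mk' F x (((ψ : S → ℝ) • σ) x)) :=
    ContMDiffOn.smul_section_of_tsupport ψ.contMDiff.contMDiffOn hU hψ hσ
  have smooth_derivative := (CovariantDerivative.ContMDiffCovariantDerivative.contMDiff (cov := ω₀)
    (k := ∞)).contMDiff (σ := (ψ : S → ℝ) • σ) smooth_cutoff.contMDiffOn x₀ (Set.mem_univ x₀)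
  rw [contMDiffWithinAt_univ] at smooth_derivative
  refine (smooth_derivative.clm_bundle_apply hX).congr_of_eventuallyEq ?_
  filter_upwards [hU.mem_nhds hx₀, ψ.eventuallyEq_one.eventually_nhds] with x hx hψx
  rw [ω₀.isCovariantDerivativeOnUniv.congr_of_eventuallyEq (σ' := (ψ : S → ℝ) • σ)
    ((hσ.contMDiffAt (hU.mem_nhds hx)).mdifferentiableAt (by simp))
    (smooth_cutoff.contMDiffAt.mdifferentiableAt (by simp)) Filter.univ_mem]
  filter_upwards [hψx] with y hy
  rw [Pi.smul_apply', hy, Pi.one_apply, one_smul]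

/-- The torsion `∇_X (e Y) - ∇_Y (e X) - e [X, Y]` of the coframe with respect to `∇ = ω₀`. -/
def torsion (e : BoundaryCoframe E F V) (ω₀ : CovariantDerivative 𝓘(ℝ, E) F V) (x : S)
    (X Y : (y : S) → TangentSpace 𝓘(ℝ, E) y) : V x :=
  ω₀ (fun y ↦ e.toFun y (Y y)) x (X x) - ω₀ (fun y ↦ e.toFun y (X y)) x (Y x)
    - e.toFun x (VectorField.mlieBracket 𝓘(ℝ, E) X Y x)

theorem torsion_swap (e : BoundaryCoframe E F V) (ω₀ : CovariantDerivative 𝓘(ℝ, E) F V) (x : S)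
    (X Y : (y : S) → TangentSpace 𝓘(ℝ, E) y) : torsion e ω₀ x X Y = -torsion e ω₀ x Y X := by
  rw [torsion, torsion, VectorField.mlieBracket_swap_apply, map_neg]
  abel

theorem mdifferentiableAt_coframe_apply (e : BoundaryCoframe E F V) {x : S}
    {s : (x : S) → TangentSpace 𝓘(ℝ, E) x}
    (hs : MDifferentiableAt 𝓘(ℝ, E) (𝓘(ℝ, E).prod 𝓘(ℝ, E)) (fun x ↦ TotalSpace.mk' E x (s x)) x) :
    MDifferentiableAt 𝓘(ℝ, E) (𝓘(ℝ, E).prod 𝓘(ℝ, F))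
      (fun x ↦ TotalSpace.mk' F x (e.toFun x (s x))) x :=
  ((e.contMDiff x).mdifferentiableAt (by simp)).clm_bundle_apply hs

/-- The term `(X f) e Y` of `∇_X (e (f Y))` cancels against the one of `e [X, f Y]`. -/
theorem tensorialAt_torsion_left [CompleteSpace E] (e : BoundaryCoframe E F V)
    (ω₀ : CovariantDerivative 𝓘(ℝ, E) F V) (x : S) (Y : (y : S) → TangentSpace 𝓘(ℝ, E) y) :
    TensorialAt 𝓘(ℝ, E) E (fun X ↦ torsion e ω₀ x X Y) x where
  smul {f X} hf hX := by
    have coframe_smul : (fun y ↦ e.toFun y ((f • X) y)) = f • fun y ↦ e.toFun y (X y) :=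
      funext fun y ↦ map_smul _ _ _
    rw [torsion, torsion, coframe_smul,
      ω₀.isCovariantDerivativeOnUniv.leibniz (mdifferentiableAt_coframe_apply e hX) hf,
      VectorField.mlieBracket_smul_left hf hX]
    simp only [Pi.smul_apply', map_add, map_neg, map_smul, add_apply, smul_apply,
      ContinuousLinearMap.smulRight_apply, neg_smul]
    module
  add {X X'} hX hX' := by
    have coframe_add : (fun y ↦ e.toFun y ((X + X') y)) =
        (fun y ↦ e.toFun y (X y)) + fun y ↦ e.toFun y (X' y) :=
      funext fun y ↦ map_add _ _ _
    rw [torsion, torsion, torsion, coframe_add,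
      ω₀.isCovariantDerivativeOnUniv.add (mdifferentiableAt_coframe_apply e hX)
        (mdifferentiableAt_coframe_apply e hX'),
      VectorField.mlieBracket_add_left hX hX']
    simp only [Pi.add_apply, map_add, add_apply]
    abel

theorem tensorialAt_torsion_right [CompleteSpace E] (e : BoundaryCoframe E F V)
    (ω₀ : CovariantDerivative 𝓘(ℝ, E) F V) (x : S) (X : (y : S) → TangentSpace 𝓘(ℝ, E) y) :
    TensorialAt 𝓘(ℝ, E) E (torsion e ω₀ x X) x where
  smul {f Y} hf hY := by
    rw [torsion_swap, (tensorialAt_torsion_left e ω₀ x X).smul hf hY, torsion_swap _ _ _ X,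
      smul_neg]
  add {Y Y'} hY hY' := by
    rw [torsion_swap, (tensorialAt_torsion_left e ω₀ x X).add hY hY', torsion_swap _ _ _ X,
      torsion_swap _ _ _ X, neg_add]

theorem contMDiffAt_torsion [FiniteDimensional ℝ E] [T2Space S] (e : BoundaryCoframe E F V)
    (ω₀ : CovariantDerivative 𝓘(ℝ, E) F V) [CovariantDerivative.ContMDiffCovariantDerivative ω₀ ∞]
    {U : Set S} (hU : IsOpen U) {x₀ : S} (hx₀ : x₀ ∈ U) {X Y : (x : S) → TangentSpace 𝓘(ℝ, E) x}
    (hX : ContMDiffOn 𝓘(ℝ, E) (𝓘(ℝ, E).prod 𝓘(ℝ, E)) ∞ (fun x ↦ TotalSpace.mk' E x (X x)) U)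
    (hY : ContMDiffOn 𝓘(ℝ, E) (𝓘(ℝ, E).prod 𝓘(ℝ, E)) ∞ (fun x ↦ TotalSpace.mk' E x (Y x)) U) :
    ContMDiffAt 𝓘(ℝ, E) (𝓘(ℝ, E).prod 𝓘(ℝ, F)) ∞
      (fun x ↦ TotalSpace.mk' F x (torsion e ω₀ x X Y)) x₀ := by
  have coframe_apply {Z : (x : S) → TangentSpace 𝓘(ℝ, E) x}
      (hZ : ContMDiffOn 𝓘(ℝ, E) (𝓘(ℝ, E).prod 𝓘(ℝ, E)) ∞ (fun x ↦ TotalSpace.mk' E x (Z x)) U) :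
      ContMDiffOn 𝓘(ℝ, E) (𝓘(ℝ, E).prod 𝓘(ℝ, F)) ∞
        (fun x ↦ TotalSpace.mk' F x (e.toFun x (Z x))) U := fun x hx ↦
    (contMDiffAt_coframe_apply e (hZ.contMDiffAt (hU.mem_nhds hx))).contMDiffWithinAt
  have hX₀ := hX.contMDiffAt (hU.mem_nhds hx₀)
  have hY₀ := hY.contMDiffAt (hU.mem_nhds hx₀)
  have : IsManifold 𝓘(ℝ, E) (((⊤ : ℕ∞) : ℕ∞ω) + 1) S := inferInstanceAs (IsManifold 𝓘(ℝ, E) ∞ S)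
  have : IsManifold 𝓘(ℝ, E) (minSmoothness ℝ 2) S := by
    rw [minSmoothness_of_isRCLikeNormedField]
    infer_instance
  have smooth_bracket := ContMDiffAt.mlieBracket_vectorField (m := ⊤) (n := ⊤) hX₀ hY₀ (by simp)
  exact ((contMDiffAt_covariantDerivative_apply ω₀ hU hx₀ (coframe_apply hY) hX₀).sub_section
    (contMDiffAt_covariantDerivative_apply ω₀ hU hx₀ (coframe_apply hX) hY₀)).sub_section
      (contMDiffAt_coframe_apply e smooth_bracket)

variable [FiniteDimensional ℝ E]

/-- The torsion `d_{ω₀} e` at `x`, as a bilinear map on the tangent space. -/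
def torsionAt (e : BoundaryCoframe E F V) (ω₀ : CovariantDerivative 𝓘(ℝ, E) F V) (x : S) :
    TangentSpace 𝓘(ℝ, E) x →ₗ[ℝ] TangentSpace 𝓘(ℝ, E) x →ₗ[ℝ] V x :=
  ContinuousLinearMap.coeLM ℝ ∘ₗ
    (TensorialAt.mkHom₂ (I := 𝓘(ℝ, E)) (F := E) (F' := E) (torsion e ω₀ x) x
      (fun Y _ ↦ tensorialAt_torsion_left e ω₀ x Y)
      (fun X _ ↦ tensorialAt_torsion_right e ω₀ x X) :
        TangentSpace 𝓘(ℝ, E) x →ₗ[ℝ] TangentSpace 𝓘(ℝ, E) x →L[ℝ] V x)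

theorem torsionAt_apply (e : BoundaryCoframe E F V) (ω₀ : CovariantDerivative 𝓘(ℝ, E) F V)
    {x : S} {X Y : (y : S) → TangentSpace 𝓘(ℝ, E) y}
    (hX : MDifferentiableAt 𝓘(ℝ, E) (𝓘(ℝ, E).prod 𝓘(ℝ, E)) (fun x ↦ TotalSpace.mk' E x (X x)) x)
    (hY : MDifferentiableAt 𝓘(ℝ, E) (𝓘(ℝ, E).prod 𝓘(ℝ, E)) (fun x ↦ TotalSpace.mk' E x (Y x)) x) :
    torsionAt e ω₀ x (X x) (Y x) = torsion e ω₀ x X Y :=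
  TensorialAt.mkHom₂_apply (fun Y _ ↦ tensorialAt_torsion_left e ω₀ x Y)
    (fun X _ ↦ tensorialAt_torsion_right e ω₀ x X) hX hY

theorem torsionValue_eq (η : LorentzMetric E F V) (e : BoundaryCoframe E F V)
    (ω₀ : CovariantDerivative 𝓘(ℝ, E) F V) (A : FormField E V) (x : S)
    (u w : TangentSpace 𝓘(ℝ, E) x) : torsionValue η e ω₀ A x u w =
      torsionAt e ω₀ x u w + (act η (A x) u (e.toFun x w) - act η (A x) w (e.toFun x u)) := by
  have extended : torsionAt e ω₀ x u w =
      torsion e ω₀ x (FiberBundle.extend E u) (FiberBundle.extend E w) := rfl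
  rw [extended]
  simp only [torsionValue, covDeriv, torsion, FiberBundle.extend_apply_self]
  abel

/-- The torsion `d_{ω₀} e`, as a field of bidegree `(2, 1)`; the factor `1/2` is there because
`twoForm` sums over all ordered pairs of indices. -/
def torsionForm (e : BoundaryCoframe E F V) (ω₀ : CovariantDerivative 𝓘(ℝ, E) F V) :
    FormField E V := fun x ↦
  (1 / 2 : ℝ) • twoForm (tangentBasis x) (torsionAt e ω₀ x)

theorem dCoframe_eq (η : LorentzMetric E F V) (e : BoundaryCoframe E F V)
    (ω₀ : CovariantDerivative 𝓘(ℝ, E) F V) {A : FormField E V} (hA : A ∈ Omega E F V 1 2) :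
    dCoframe η e ω₀ A = torsionForm e ω₀ + rho η e A := by
  funext x
  have hAx := hA.1 x
  have value_eq (u w : TangentSpace 𝓘(ℝ, E) x) : torsionValue η e ω₀ A x u w =
      (torsionAt e ω₀ x +
        value (bracket (tangentBasis x) (coframeAt e x) (flatMap η x) (A x))) u w := by
    rw [torsionValue_eq, act_eq η hAx, act_eq η hAx, LinearMap.add_apply, LinearMap.add_apply,
      value_bracket _ _ _ hAx]
    rfl
  have expand : dCoframe η e ω₀ A x = (1 / 2 : ℝ) • twoForm (tangentBasis x) (torsionAt e ω₀ x +
      value (bracket (tangentBasis x) (coframeAt e x) (flatMap η x) (A x))) := by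
    simp only [dCoframe, value_eq]
    rfl
  rw [expand, map_add, twoForm_value _ (bracket_mem_bideg _ _ _ hAx), smul_add, smul_smul,
    Pi.add_apply, rho_apply η e hAx, torsionForm]
  norm_num

theorem dCoframe_sub (η : LorentzMetric E F V) (e : BoundaryCoframe E F V)
    (ω₀ : CovariantDerivative 𝓘(ℝ, E) F V) {A B : FormField E V} (hA : A ∈ Omega E F V 1 2)
    (hB : B ∈ Omega E F V 1 2) :
    dCoframe η e ω₀ (A - B) = dCoframe η e ω₀ A - rho η e B := by
  rw [dCoframe_eq η e ω₀ hA, dCoframe_eq η e ω₀ (Submodule.sub_mem _ hA hB), map_sub, add_sub]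

variable [FiniteDimensional ℝ F] [T2Space S]

theorem torsionForm_mem_Omega (e : BoundaryCoframe E F V)
    (ω₀ : CovariantDerivative 𝓘(ℝ, E) F V)
    [CovariantDerivative.ContMDiffCovariantDerivative ω₀ ∞] :
    torsionForm e ω₀ ∈ Omega E F V 2 1 := by
  refine ⟨fun x ↦ Submodule.smul_mem _ _ (twoForm_mem_bideg _ _),
    isSmoothField_iff.mpr fun x₀ ↦ ?_⟩
  have smooth_term (μ ν) := (weaklySmoothAt_section (contMDiffAt_torsion e ω₀
    (tanTriv E x₀).open_baseSet (mem_baseSet_tanTriv E x₀) (contMDiffOn_tanFrame x₀ μ)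
      (contMDiffOn_tanFrame x₀ ν))).map (LinearMap.mulLeft ℝ (ofDual ((finBasis ℝ E).coord μ) *
        ofDual ((finBasis ℝ E).coord ν)) ∘ₗ ofVec)
  refine ((WeaklySmoothAt.sum (s := Finset.univ) fun μ _ ↦ WeaklySmoothAt.sum (s := Finset.univ)
    fun ν _ ↦ smooth_term μ ν).map ((1 / 2 : ℝ) • LinearMap.id)).congr ?_
  filter_upwards [eventually_mem_baseSet_tanTriv E x₀] with x hx
  have hframe (μ) := (contMDiffAt_tanFrame hx μ).mdifferentiableAt (by simp)
  rw [torsionForm, twoForm_basis_change _ (tanBasis hx), twoForm_apply, map_smul, map_sum]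
  refine congrArg _ (Finset.sum_congr rfl fun μ _ ↦ ?_)
  rw [map_sum]
  refine Finset.sum_congr rfl fun ν _ ↦ ?_
  rw [map_mul, map_mul, chartMap_ofDual_coord_tanBasis, chartMap_ofDual_coord_tanBasis,
    chartMap_ofVec, ← tanFrame_eq hx, ← tanFrame_eq hx,
    torsionAt_apply e ω₀ (hframe μ) (hframe ν)]
  rfl

theorem dCoframe_mem_Omega [ContMDiffVectorBundle ∞ F V 𝓘(ℝ, E)] (η : LorentzMetric E F V)
    (e : BoundaryCoframe E F V) (ω₀ : CovariantDerivative 𝓘(ℝ, E) F V)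
    [CovariantDerivative.ContMDiffCovariantDerivative ω₀ ∞] {A : FormField E V}
    (hA : A ∈ Omega E F V 1 2) : dCoframe η e ω₀ A ∈ Omega E F V 2 1 := by
  rw [dCoframe_eq η e ω₀ hA]
  exact Submodule.add_mem _ (torsionForm_mem_Omega e ω₀) (rho_mem_Omega η e hA)

end Torsion

theorem MixedExterior.Splitting.IsPrimitive.basis_change {R T W κ ι : Type*} [CommRing R]
    [AddCommGroup T] [Module R T] [AddCommGroup W] [Module R W] [Fintype κ] [Fintype ι]
    {b : Basis κ R T} {e : T →ₗ[R] W} {n : W} {s : Splitting e n} {X : MixedExterior R T W}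
    (hX : s.IsPrimitive b X) (b' : Basis ι R T) : s.IsPrimitive b' X :=
  ⟨hX.1, (trace_basis_change b' b s.proj X).trans hX.2⟩

section Orthogonality

variable {E : Type*} [NormedAddCommGroup E] [NormedSpace ℝ E]
  {S : Type*} [TopologicalSpace S] [ChartedSpace E S] [IsManifold 𝓘(ℝ, E) ∞ S]
  {F : Type*} [NormedAddCommGroup F] [NormedSpace ℝ F]
  {V : S → Type*} [TopologicalSpace (TotalSpace F V)]
  [∀ x, AddCommGroup (V x)] [∀ x, Module ℝ (V x)] [∀ x, TopologicalSpace (V x)]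
  [FiberBundle F V] [VectorBundle ℝ F V]
  {h : ContMDiffRiemannianMetric 𝓘(ℝ, E) ∞ E (TangentSpace 𝓘(ℝ, E) : S → Type _)}
  {G : ContMDiffRiemannianMetric 𝓘(ℝ, E) ∞ F V}

theorem Orthogonal21.sub_left {α β θ : FormField E V} (hα : Orthogonal21 h G α θ)
    (hβ : Orthogonal21 h G β θ) : Orthogonal21 h G (α - β) θ := by
  intro x b hb
  have value_sub (u w) : value ((α - β) x) u w = value (α x) u w - value (β x) u w := by
    simp [value]
  have difference := congrArg₂ (· - ·) (hα x b hb) (hβ x b hb)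
  simp only [sub_self, ← Finset.sum_sub_distrib] at difference
  refine Eq.trans (Finset.sum_congr rfl fun i _ ↦ Finset.sum_congr rfl fun j _ ↦ ?_) difference
  refine (congrArg (G.inner x · _) (value_sub (b i) (b j))).trans ?_
  rw [map_sub, sub_apply]
  rfl

variable [FiniteDimensional ℝ E]

theorem exists_basis_orthonormal
    (h : ContMDiffRiemannianMetric 𝓘(ℝ, E) ∞ E (TangentSpace 𝓘(ℝ, E) : S → Type _)) (x : S) :
    ∃ b : Basis (Fin (finrank ℝ E)) ℝ (TangentSpace 𝓘(ℝ, E) x),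
      ∀ i j, h.inner x (b i) (b j) = if i = j then 1 else 0 := by
  let core := h.toRiemannianMetric.toCore x
  let : NormedAddCommGroup (TangentSpace 𝓘(ℝ, E) x) := core.toNormedAddCommGroup
  let : InnerProductSpace ℝ (TangentSpace 𝓘(ℝ, E) x) := .ofCore core.toCore
  have : FiniteDimensional ℝ (TangentSpace 𝓘(ℝ, E) x) := inferInstanceAs (FiniteDimensional ℝ E)
  let b := stdOrthonormalBasis ℝ (TangentSpace 𝓘(ℝ, E) x)
  have coe_eq (i) : b.toBasis i = b i := congrFun b.coe_toBasis i
  exact ⟨b.toBasis, fun i j ↦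
    (congrArg₂ (h.inner x · ·) (coe_eq i) (coe_eq j)).trans (b.inner_eq_ite i j)⟩

theorem eq_zero_of_orthogonal21_self {θ : FormField E V} (hθ : θ ∈ Omega E F V 2 1)
    (h_self : Orthogonal21 h G θ θ) : θ = 0 := by
  funext x
  obtain ⟨b, hb⟩ := exists_basis_orthonormal h x
  have inner_nonneg (v : V x) : 0 ≤ G.inner x v v := by
    obtain rfl | hv := eq_or_ne v 0
    · simp
    · exact (G.pos x v hv).le
  have value_eq_zero : value (θ x) = 0 := b.ext fun i ↦ b.ext fun j ↦ by
    have sum_eq_zero := h_self x b hb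
    rw [Finset.sum_eq_zero_iff_of_nonneg fun i _ ↦ Finset.sum_nonneg fun j _ ↦ inner_nonneg _]
      at sum_eq_zero
    have term_eq_zero := (Finset.sum_eq_zero_iff_of_nonneg fun j _ ↦ inner_nonneg _).mp
      (sum_eq_zero i (Finset.mem_univ i)) j (Finset.mem_univ j)
    exact by_contra fun hne ↦ (G.pos x _ hne).ne' term_eq_zero
  have two_smul_eq_zero := twoForm_value b (hθ.1 x)
  rw [value_eq_zero, map_zero] at two_smul_eq_zero
  exact (smul_eq_zero.mp two_smul_eq_zero.symm).resolve_left two_ne_zero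

variable [∀ x, IsTopologicalAddGroup (V x)] [∀ x, ContinuousSMul ℝ (V x)]
  {e : BoundaryCoframe E F V} {en : TransversalSection E F V e}

theorem orthogonal21_of_mem_lefschetzComplement
    (s : ∀ x, Splitting (coframeAt e x) (en.toFun x)) {k : ℕ} (hk : k + 2 = finrank ℝ E)
    (hG : ExtendsMetric e en h G) {Z θ : FormField E V} (hZ : Z ∈ lefschetzComplement en)
    (hθ : θ ∈ kerW e k 2 1) : Orthogonal21 h G Z θ := by
  obtain ⟨ξ, hξ, B, hB, rfl⟩ := mem_lefschetzComplement_iff.mp hZ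
  obtain ⟨hθ, hprim⟩ := (mem_kerW_iff_isPrimitive s hk).mp hθ
  intro x b hb
  let g : V x →ₗ[ℝ] V x →ₗ[ℝ] ℝ :=
    (G.inner x).toLinearMap₁₂
  have coframe_inner (i) (u : TangentSpace 𝓘(ℝ, E) x) :
      g (coframeAt e x (b i)) (coframeAt e x u) = b.coord i u := by
    refine ((hG x (b i)).2 u).trans ?_
    suffices (h.inner x (b i) : TangentSpace 𝓘(ℝ, E) x →ₗ[ℝ] ℝ) = b.coord i from
      LinearMap.congr_fun this u
    refine b.ext fun j ↦ ?_
    refine (hb i j).trans ?_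
    rw [Basis.coord_apply, b.repr_self_apply]
    simp only [eq_comm]
  have orthogonal := ((hprim x).basis_change b).sum_inner_value_eq_zero (hθ.1 x) g
    (fun u ↦ (hG x u).1) coframe_inner (hξ.1 x) (hB.1 x)
  rw [← coframeForm_eq] at orthogonal
  exact orthogonal

theorem IsOrthogonalProjection21.eq_zero_of_mem_lefschetzComplement [FiniteDimensional ℝ F]
    (s : ∀ x, Splitting (coframeAt e x) (en.toFun x)) {k : ℕ} (hk : k + 2 = finrank ℝ E)
    (hG : ExtendsMetric e en h G) {T : Submodule ℝ (FormField E V)} (hT : T ≤ kerW e k 2 1)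
    {p : FormField E V →ₗ[ℝ] FormField E V} (hp : IsOrthogonalProjection21 h G T p)
    {Z : FormField E V} (hZ : Z ∈ lefschetzComplement en) : p Z = 0 := by
  have hZΩ := lefschetzComplement_le hZ
  have hpZ := hp.1.2.1 Z hZΩ
  have orthogonal := (orthogonal21_of_mem_lefschetzComplement s hk hG hZ (hT hpZ)).sub_left
    (hp.2 Z hZΩ _ hpZ)
  rw [sub_sub_cancel] at orthogonal
  exact eq_zero_of_orthogonal21_self (hp.1.1 hpZ) orthogonal

end Orthogonality

section Decomposition

theorem existsUnique_sub_map_mem {R M M' : Type*} [Ring R] [AddCommGroup M] [Module R M]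
    [AddCommGroup M'] [Module R M'] {f : M →ₗ[R] M'} {A : Submodule R M} {P : Submodule R M'}
    (hdisj : Disjoint (A.map f) P) {p : M →ₗ[R] M} (hp : ∀ v ∈ A, p v ∈ A ⊓ LinearMap.ker f)
    (hp_self : ∀ v ∈ A ⊓ LinearMap.ker f, p v = v) {q : M'} (hq : q ∈ A.map f ⊔ P) :
    ∃! v, v ∈ A ∧ q - f v ∈ P ∧ p v = 0 := by
  obtain ⟨_, ⟨v, hv, rfl⟩, t, ht, rfl⟩ := Submodule.mem_sup.mp hq
  obtain ⟨hpvA, hpv⟩ := hp v hv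
  refine ⟨v - p v, ⟨A.sub_mem hv hpvA, ?_, ?_⟩, fun w ⟨hw, hwP, hpw⟩ ↦ ?_⟩
  · rwa [map_sub, LinearMap.mem_ker.mp hpv, sub_zero, add_sub_cancel_left]
  · rw [map_sub, hp_self _ ⟨hpvA, hpv⟩, sub_self]
  · have difference_mem : f (v - w) ∈ P := by
      rw [map_sub]
      simpa [add_sub_right_comm] using P.sub_mem hwP ht
    have difference_ker : f (v - w) = 0 :=
      Submodule.disjoint_def.mp hdisj _ ⟨v - w, A.sub_mem hv hw, rfl⟩ difference_mem
    have := hp_self (v - w) ⟨A.sub_mem hv hw, difference_ker⟩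
    rw [map_sub, hpw, sub_zero] at this
    rw [this, sub_sub_cancel]

variable {E : Type*} [NormedAddCommGroup E] [NormedSpace ℝ E]
  {S : Type*} [TopologicalSpace S] [ChartedSpace E S]
  {F : Type*} [NormedAddCommGroup F] [NormedSpace ℝ F]
  {V : S → Type*} [∀ x, AddCommGroup (V x)] [∀ x, Module ℝ (V x)]

theorem IsProjection.sub_mem_iff_mem_sup {D T C : Submodule ℝ (FormField E V)}
    {p : FormField E V →ₗ[ℝ] FormField E V} (hp : IsProjection D T p) (hC : ∀ Z ∈ C, p Z = 0)
    {α : FormField E V} (hα : α ∈ D) : α - p α ∈ C ↔ α ∈ T ⊔ C := by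
  refine ⟨fun hmem ↦ ?_, fun hmem ↦ ?_⟩
  · rw [← add_sub_cancel (p α) α]
    exact Submodule.add_mem_sup (hp.2.1 α hα) hmem
  · obtain ⟨t, ht, Z, hZ, rfl⟩ := Submodule.mem_sup.mp hmem
    rwa [map_add, hp.2.2 t ht, hC Z hZ, add_zero, add_sub_cancel_left]

variable [FiniteDimensional ℝ E] [IsManifold 𝓘(ℝ, E) ∞ S]
  [FiniteDimensional ℝ F] [TopologicalSpace (TotalSpace F V)] [∀ x, TopologicalSpace (V x)]
  [∀ x, IsTopologicalAddGroup (V x)] [∀ x, ContinuousSMul ℝ (V x)]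
  [FiberBundle F V] [VectorBundle ℝ F V]
  {η : LorentzMetric E F V} {e : BoundaryCoframe E F V} {en : TransversalSection E F V e}
  {J : Submodule ℝ (FormField E V)} {N : ℕ}

theorem structural_constraint_iff (s : ∀ x, Splitting (coframeAt e x) (en.toFun x))
    {h : ContMDiffRiemannianMetric 𝓘(ℝ, E) ∞ E (TangentSpace 𝓘(ℝ, E) : S → Type _)}
    {G : ContMDiffRiemannianMetric 𝓘(ℝ, E) ∞ F V} (hG : ExtendsMetric e en h G)
    (hN : 4 ≤ N) (hE : finrank ℝ E + 1 = N) {p : FormField E V →ₗ[ℝ] FormField E V}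
    (hp : IsOrthogonalProjection21 h G (spaceT e N J) p) {X : FormField E V}
    (hX : X ∈ Omega E F V 2 1) :
    transversalForm en * coframeForm e ^ (N - 4) * X
        - transversalForm en * coframeForm e ^ (N - 4) * p X ∈ imW e (N - 3) 1 1 ↔
      X ∈ spaceT e N J ⊔ lefschetzComplement en := by
  have vanish (Z) (hZ : Z ∈ lefschetzComplement en) : p Z = 0 :=
    hp.eq_zero_of_mem_lefschetzComplement s (by omega) hG inf_le_left hZ
  have hXp : X - p X ∈ Omega E F V 2 1 := Submodule.sub_mem _ hX (hp.1.1 (hp.1.2.1 X hX))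
  rw [← mul_sub, ← hp.1.sub_mem_iff_mem_sup vanish hX, show N - 3 = N - 4 + 1 by omega]
  exact transversalForm_mul_mem_imW_iff s (by omega) hXp

variable [ContMDiffVectorBundle ∞ F V 𝓘(ℝ, E)]

theorem imRho_le_kerW : imRho η e N ≤ kerW e (N - 3) 2 1 :=
  Submodule.map_le_iff_le_comap.mpr fun _ hX ↦ rho_mem_kerW η e hX

theorem imRho_sup_spaceT (hJ : IsComplement η e N J) :
    imRho η e N ⊔ spaceT e N J = kerW e (N - 3) 2 1 := by
  rw [spaceT, inf_comm, ← sup_inf_assoc_of_le _ imRho_le_kerW, hJ.2]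
  exact inf_of_le_right inf_le_left

theorem disjoint_imRho_spaceT_sup (s : ∀ x, Splitting (coframeAt e x) (en.toFun x))
    (hN : N - 3 + 2 = finrank ℝ E) (hJ : IsComplement η e N J) :
    Disjoint (imRho η e N) (spaceT e N J ⊔ lefschetzComplement en) := by
  have disjoint_spaceT : Disjoint (imRho η e N) (spaceT e N J) :=
    (disjoint_iff.mpr hJ.1).mono_right inf_le_right
  refine disjoint_spaceT.disjoint_sup_right_of_disjoint_sup_left ?_
  rw [imRho_sup_spaceT hJ]
  exact disjoint_kerW_lefschetzComplement s hN

theorem imRho_sup_spaceT_sup (s : ∀ x, Splitting (coframeAt e x) (en.toFun x))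
    (hN : N - 3 + 2 = finrank ℝ E) (hJ : IsComplement η e N J) :
    imRho η e N ⊔ (spaceT e N J ⊔ lefschetzComplement en) = Omega E F V 2 1 := by
  rw [← sup_assoc, imRho_sup_spaceT hJ, kerW_sup_lefschetzComplement s hN]

end Decomposition

end PalatiniCartan

end

open PalatiniCartan in
theorem mainTheorem3_general
    (N : ℕ) (hN : 4 ≤ N)
    {E : Type*} [NormedAddCommGroup E] [NormedSpace ℝ E] [FiniteDimensional ℝ E]
    (hE : finrank ℝ E + 1 = N)
    {S : Type*} [TopologicalSpace S] [T2Space S]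
    [ChartedSpace E S] [IsManifold 𝓘(ℝ, E) ∞ S]
    {F : Type*} [NormedAddCommGroup F] [NormedSpace ℝ F] [FiniteDimensional ℝ F]
    (hF : finrank ℝ F = N)
    {V : S → Type*} [TopologicalSpace (TotalSpace F V)]
    [∀ x, AddCommGroup (V x)] [∀ x, Module ℝ (V x)] [∀ x, TopologicalSpace (V x)]
    [∀ x, IsTopologicalAddGroup (V x)] [∀ x, ContinuousSMul ℝ (V x)]
    [FiberBundle F V] [VectorBundle ℝ F V] [ContMDiffVectorBundle ∞ F V 𝓘(ℝ, E)]
    (η : LorentzMetric E F V)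
    (e : BoundaryCoframe E F V)
    (en : TransversalSection E F V e)
    (ω₀ : CovariantDerivative 𝓘(ℝ, E) F V)
    [CovariantDerivative.ContMDiffCovariantDerivative ω₀ ∞]
    (h : ContMDiffRiemannianMetric 𝓘(ℝ, E) ∞ E (TangentSpace 𝓘(ℝ, E) : S → Type _))
    (G : ContMDiffRiemannianMetric 𝓘(ℝ, E) ∞ F V)
    (hG : ExtendsMetric e en h G)
    (J : Submodule ℝ (FormField E V))
    (hJ : IsComplement η e N J)
    (pT : FormField E V →ₗ[ℝ] FormField E V)
    (hpT : IsOrthogonalProjection21 h G (spaceT e N J) pT)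
    (pK : FormField E V →ₗ[ℝ] FormField E V)
    (hpK : IsProjection (Omega E F V 1 2) (spaceK η e N) pK)
    (ω' : FormField E V) (hω' : ω' ∈ Omega E F V 1 2) :
    ∃! p : FormField E V × FormField E V,
      p.1 ∈ Omega E F V 1 2 ∧ p.2 ∈ Omega E F V 1 2 ∧
      ω' = p.1 + p.2 ∧
      coframeForm e ^ (N - 3) * p.2 = 0 ∧
      transversalForm en * coframeForm e ^ (N - 4) * dCoframe η e ω₀ p.1
        - transversalForm en * coframeForm e ^ (N - 4) * pT (dCoframe η e ω₀ p.1)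
        ∈ imW e (N - 3) 1 1 ∧
      pK p.2 = 0 := by
  let s := splitting en (hE.trans hF.symm)
  have hdim : N - 3 + 2 = finrank ℝ E := by omega
  have constraint_iff {v : FormField E V} (hv : v ∈ Omega E F V 1 2) :=
    structural_constraint_iff s hG hN hE hpT
      (dCoframe_mem_Omega η e ω₀ (Submodule.sub_mem _ hω' hv))
  have decomposition : dCoframe η e ω₀ ω' ∈
      imRho η e N ⊔ (spaceT e N J ⊔ lefschetzComplement en) := by
    rw [imRho_sup_spaceT_sup s hdim hJ]
    exact dCoframe_mem_Omega η e ω₀ hω'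
  obtain ⟨v, ⟨hv, hconstraint, hpv⟩, unique⟩ :=
    existsUnique_sub_map_mem (disjoint_imRho_spaceT_sup s hdim hJ)
      (fun v hv ↦ hpK.2.1 v hv.1) hpK.2.2 decomposition
  rw [← dCoframe_sub η e ω₀ hω' hv.1, ← constraint_iff hv.1] at hconstraint
  refine ⟨(ω' - v, v), ⟨Submodule.sub_mem _ hω' hv.1, hv.1, (sub_add_cancel ω' v).symm,
    (mem_kerW_iff.mp hv).2, hconstraint, hpv⟩, ?_⟩
  rintro ⟨ω₁, w⟩ ⟨-, hw, hsum, hker, hw_constraint, hpw⟩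
  obtain rfl : ω₁ = ω' - w := eq_sub_of_add_eq hsum.symm
  rw [constraint_iff hw, dCoframe_sub η e ω₀ hω' hw] at hw_constraint
  rw [unique w ⟨mem_kerW_iff.mpr ⟨hw, hker⟩, hw_constraint, hpw⟩]

open PalatiniCartan in
theorem mainTheorem3
    (N : ℕ) (hN : 4 ≤ N)
    {E : Type*} [NormedAddCommGroup E] [NormedSpace ℝ E] [FiniteDimensional ℝ E]
    (hE : Module.finrank ℝ E + 1 = N)
    {S : Type*} [TopologicalSpace S] [T2Space S] [SecondCountableTopology S]
    [ChartedSpace E S] [IsManifold 𝓘(ℝ, E) ∞ S]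
    {F : Type*} [NormedAddCommGroup F] [NormedSpace ℝ F] [FiniteDimensional ℝ F]
    (hF : Module.finrank ℝ F = N)
    {V : S → Type*} [TopologicalSpace (Bundle.TotalSpace F V)]
    [∀ x, AddCommGroup (V x)] [∀ x, Module ℝ (V x)] [∀ x, TopologicalSpace (V x)]
    [∀ x, IsTopologicalAddGroup (V x)] [∀ x, ContinuousSMul ℝ (V x)]
    [FiberBundle F V] [VectorBundle ℝ F V] [ContMDiffVectorBundle ∞ F V 𝓘(ℝ, E)]
    (η : LorentzMetric E F V)
    (e : BoundaryCoframe E F V)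
    (hdeg : IsDegenerate η e)
    (en : TransversalSection E F V e)
    (ω₀ : CovariantDerivative 𝓘(ℝ, E) F V)
    [CovariantDerivative.ContMDiffCovariantDerivative ω₀ ∞]
    (hω₀ : IsMetricConnection η ω₀)
    (h : Bundle.ContMDiffRiemannianMetric 𝓘(ℝ, E) ∞ E (TangentSpace 𝓘(ℝ, E) : S → Type _))
    (G : Bundle.ContMDiffRiemannianMetric 𝓘(ℝ, E) ∞ F V)
    (hG : ExtendsMetric e en h G)
    (J : Submodule ℝ (FormField E V))
    (hJ : IsComplement η e N J)
    (pT : FormField E V →ₗ[ℝ] FormField E V)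
    (hpT : IsOrthogonalProjection21 h G (spaceT e N J) pT)
    (pK : FormField E V →ₗ[ℝ] FormField E V)
    (hpK : IsProjection (Omega E F V 1 2) (spaceK η e N) pK)
    (ω' : FormField E V) (hω' : ω' ∈ Omega E F V 1 2) :
    ∃! p : FormField E V × FormField E V,
      p.1 ∈ Omega E F V 1 2 ∧ p.2 ∈ Omega E F V 1 2 ∧
      ω' = p.1 + p.2 ∧
      coframeForm e ^ (N - 3) * p.2 = 0 ∧
      transversalForm en * coframeForm e ^ (N - 4) * dCoframe η e ω₀ p.1
        - transversalForm en * coframeForm e ^ (N - 4) * pT (dCoframe η e ω₀ p.1)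
        ∈ imW e (N - 3) 1 1 ∧
      pK p.2 = 0 :=
  mainTheorem3_general N hN hE hF η e en ω₀ h G hG J hJ pT hpT pK hpK ω' hω'
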